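/- Let $x\in\mathbb R^{n_x}$, $y\in\mathbb R^{n_y}$, $z\in\mathbb R^{n_z}$ be zero-mean, jointly Gaussian random vectors. For a random variable $w$ write $\Sigma_{x|w}=E\big[(x-E[x|w])(x-E[x|w])^T\big]$, and assume that $\Sigma_{x|z}-\Sigma_{x|yz}$ has full rank (equivalently, is positive definite). In the two problems below $u$ ranges over all auxiliary random vectors of arbitrary finite dimension for which $u\leftrightarrow y\leftrightarrow(x,z)$ is a Markov chain. For a symmetric matrix $\mathbf D$ let $$R(\mathbf D)=\min_u I(y;u|z)\quad\text{s.t. } \Sigma_{x|uz}\preceq \mathbf D,$$ and for a real number $D$ let $$R_{\mathrm{MSE}}(D)=\min_u I(y;u|z)\quad\text{s.t. } \operatorname{tr}(\Sigma_{x|uz})\le n_xD .$$ For symmetric positive definite $A,B$ with eigenvalue decompositions (eigenvalues in decreasing order) $A=Q^T\Lambda Q$ and $A^{-1/2}BA^{-1/2}=W^T\Gamma W$, put $V=\Lambda^{1/2}WA^{-1/2}$, so that $VAV^T=\Lambda$ and $VBV^T=\Lambda\Gamma=\Lambda'$, and let $\min(A,B)=V^{-1}\operatorname{diag}\{\min(\Lambda_{ii},\Lambda'_{ii})\}V^{-T}$.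 Let $\Sigma_{x|z}-\Sigma_{x|yz}=U^T\operatorname{diag}\{\lambda_1,\dots,\lambda_{n_x}\}U$ with $U$ orthogonal, and let $\operatorname{tr}(\Sigma_{x|yz})<n_xD\le\operatorname{tr}(\Sigma_{x|z})$. Then there is a water level $\lambda$ with $$\sum_{i=1}^{n_x}\min(\lambda,\lambda_i)=n_xD-\operatorname{tr}(\Sigma_{x|yz}),$$ and for every such $\lambda$ the matrix $$\mathbf D^*=\Sigma_{x|yz}+U^T\operatorname{diag}\{\min(\lambda,\lambda_i)\}U$$ satisfies $\mathbf D^*\succ\Sigma_{x|yz}$, the minima defining $R(\mathbf D^*)$ and $R_{\mathrm{MSE}}(D)$ are attained, and $$R(\mathbf D^*)=\frac12\log\frac{|\Sigma_{x|z}-\Sigma_{x|yz}|}{|\min(\mathbf D^*-\Sigma_{x|yz},\,\Sigma_{x|z}-\Sigma_{x|yz})|}=\frac12\sum_{i=1}^{n_x}\log\frac{\lambda_i}{\min(\lambda,\lambda_i)}=\frac12\sum_{i=1}^{n_x}\log\max\Big(\frac{\lambda_i}{\lambda},1\Big)=R_{\mathrm{MSE}}(D).$$ Thus the rate-distortion function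 of the vector Gaussian remote Wyner-Ziv problem under the mean-squared error constraint is the value of the covariance-constrained rate-distortion function at $\mathbf D^*$. -/

import Mathlib

open MeasureTheory ProbabilityTheory InformationTheory
open scoped ENNReal Matrix

namespace RemoteWynerZiv

/-! ### The minimum of two positive definite matrices -/

section MatrixMin

variable {n : ℕ}

/-- `U` and `l` form an eigenvalue decomposition `A = Uᵀ diag(l) U` of the real matrix `A`, with `U`
orthogonal; the entries of `l` are the eigenvalues of `A` with multiplicity, in any order. -/
def IsEigenDecomp (A U : Matrix (Fin n) (Fin n) ℝ) (l : Fin n → ℝ) : Prop :=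
  U ∈ Matrix.orthogonalGroup (Fin n) ℝ ∧ A = Uᵀ * Matrix.diagonal l * U

/-- `M` is the minimum of the ordered pair `(A, B)` of symmetric positive definite matrices:
with eigenvalue decompositions (eigenvalues in decreasing order) `A = Uᵀ Λ U` and
`A^{-1/2} B A^{-1/2} = Wᵀ Γ W`, where `A^{1/2} = Uᵀ Λ^{1/2} U` is the principal square root,
the joint diagonalizer is `V = Λ^{1/2} W A^{-1/2}`, so that `V A Vᵀ = Λ` and `V B Vᵀ = Λ Γ`,
and `M = V⁻¹ diag(min(λᵢ, λᵢ γᵢ)) V⁻ᵀ`. -/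
def IsMatrixMin (A B M : Matrix (Fin n) (Fin n) ℝ) : Prop :=
  ∃ (U W S V : Matrix (Fin n) (Fin n) ℝ) (l g : Fin n → ℝ),
    Antitone l ∧ IsEigenDecomp A U l ∧
    S = Uᵀ * Matrix.diagonal (fun i => Real.sqrt (l i)) * U ∧
    Antitone g ∧ IsEigenDecomp (S⁻¹ * B * S⁻¹) W g ∧
    V = Matrix.diagonal (fun i => Real.sqrt (l i)) * W * S⁻¹ ∧
    M = V⁻¹ * Matrix.diagonal (fun i => min (l i) (l i * g i)) * (V⁻¹)ᵀ

open Classical in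
/-- The minimum of two symmetric positive definite matrices (it does not depend on the choice of the
eigenvalue decompositions); the value `0` is a default for pairs that have no minimum. -/
noncomputable def matrixMin (A B : Matrix (Fin n) (Fin n) ℝ) : Matrix (Fin n) (Fin n) ℝ :=
  if h : ∃ M, IsMatrixMin A B M then h.choose else 0

lemma exists_eigenDecomp {A : Matrix (Fin n) (Fin n) ℝ} (hA : A.IsHermitian) :
    ∃ (U : Matrix (Fin n) (Fin n) ℝ) (l : Fin n → ℝ), Antitone l ∧ IsEigenDecomp A U l := by
  set Q : Matrix (Fin n) (Fin n) ℝ := (hA.eigenvectorUnitary : Matrix (Fin n) (Fin n) ℝ) with hQ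
  have hQm : Q ∈ Matrix.unitaryGroup (Fin n) ℝ := hA.eigenvectorUnitary.2
  have hQ1 : Q * Qᵀ = 1 := by
    have := (Matrix.mem_unitaryGroup_iff).1 hQm
    simpa [Matrix.star_eq_conjTranspose] using this
  have hspec : A = Q * Matrix.diagonal hA.eigenvalues * Qᵀ := by
    have := hA.spectral_theorem
    rw [Unitary.conjStarAlgAut_apply] at this
    simpa [Matrix.star_eq_conjTranspose, Function.comp_def] using this
  let s : Equiv.Perm (Fin n) := Tuple.sort (fun i => - hA.eigenvalues i)
  have hs : Monotone ((fun i => - hA.eigenvalues i) ∘ s) := Tuple.monotone_sort _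
  refine ⟨Qᵀ.submatrix s id, hA.eigenvalues ∘ s, ?_, ?_, ?_⟩
  · intro i j hij
    simpa using hs hij
  · rw [Matrix.mem_orthogonalGroup_iff']
    simp [hQ1]
  · have hd : Matrix.diagonal (hA.eigenvalues ∘ s)
        = (Matrix.diagonal hA.eigenvalues).submatrix s s := by
      simp
    rw [hd, Matrix.transpose_submatrix, Matrix.transpose_transpose,
      Matrix.submatrix_mul_equiv, Matrix.submatrix_mul_equiv]
    simpa using hspec

/-- Symmetric matrices always have a minimum in the above sense. -/
lemma exists_isMatrixMin {A B : Matrix (Fin n) (Fin n) ℝ} (hA : A.IsHermitian)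
    (hB : B.IsHermitian) : ∃ M, IsMatrixMin A B M := by
  obtain ⟨U, l, hl, hU⟩ := exists_eigenDecomp hA
  set S := Uᵀ * Matrix.diagonal (fun i => Real.sqrt (l i)) * U with hS
  have hSs : Sᵀ = S := by
    simp [hS, Matrix.transpose_mul, Matrix.mul_assoc]
  have hH : (S⁻¹ * B * S⁻¹).IsHermitian := by
    have hBt : Bᵀ = B := by simpa [Matrix.IsHermitian] using hB
    unfold Matrix.IsHermitian
    simp [Matrix.transpose_mul, Matrix.transpose_nonsing_inv, hSs, hBt, Matrix.mul_assoc]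
  obtain ⟨W, g, hg, hW⟩ := exists_eigenDecomp hH
  exact ⟨_, U, W, S, _, l, g, hl, hU, hS, hg, hW, rfl, rfl⟩

lemma isMatrixMin_matrixMin {A B : Matrix (Fin n) (Fin n) ℝ} (hA : A.IsHermitian)
    (hB : B.IsHermitian) : IsMatrixMin A B (matrixMin A B) := by
  have h := exists_isMatrixMin hA hB
  unfold matrixMin
  rw [dif_pos h]
  exact h.choose_spec

end MatrixMin

/-! ### Error covariance and conditional mutual information -/

/-- The error covariance matrix `Σ_{x|w} = E[(x - E[x|w]) (x - E[x|w])ᵀ]` of the optimal (conditional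
mean) estimate of the random vector `x` from the observation `w`. -/
noncomputable def errCov {Ω β : Type*} [MeasurableSpace Ω] [MeasurableSpace β] {n : ℕ}
    (μ : Measure Ω) (x : Ω → EuclideanSpace ℝ (Fin n)) (w : Ω → β) : Matrix (Fin n) (Fin n) ℝ :=
  Matrix.of fun i j => ∫ ω,
    (x ω i - (μ[fun ω' => x ω' i | MeasurableSpace.comap w inferInstance]) ω) *
    (x ω j - (μ[fun ω' => x ω' j | MeasurableSpace.comap w inferInstance]) ω) ∂μ

/-- The conditional mutual information `I(y; u | z)` (in nats): the Kullback-Leibler divergence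
of the joint law of `(z, y, u)` from the law under which `z` has the same distribution and, given
`z`, the variables `y` and `u` are independent with their conditional laws given `z`. -/
noncomputable def condMutualInfo {Ω α β γ : Type*} [MeasurableSpace Ω] [MeasurableSpace α]
    [StandardBorelSpace α] [Nonempty α] [MeasurableSpace β] [StandardBorelSpace β] [Nonempty β]
    [MeasurableSpace γ] (μ : Measure Ω) [IsFiniteMeasure μ] (y : Ω → α) (u : Ω → β) (z : Ω → γ) :
    ℝ≥0∞ :=
  klDiv (μ.map fun ω => (z ω, (y ω, u ω)))
    (μ.map z ⊗ₘ (condDistrib y z μ ×ₖ condDistrib u z μ))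

/-! ### The remote Wyner-Ziv problem -/

/-- The space in which the triple (source `x`, encoder observation `y`, side information `z`)
takes its values. -/
abbrev Triple (nx ny nz : ℕ) : Type :=
  EuclideanSpace ℝ (Fin nx) × EuclideanSpace ℝ (Fin ny) × EuclideanSpace ℝ (Fin nz)

section Problem

variable {nx ny nz : ℕ}

/-- `Σ_{x|z}` when `(x, y, z)` has the joint law `P`. -/
noncomputable def covXGivenZ (P : Measure (Triple nx ny nz)) : Matrix (Fin nx) (Fin nx) ℝ :=
  errCov P (fun t => t.1) (fun t => t.2.2)

/-- `Σ_{x|yz}` when `(x, y, z)` has the joint law `P`. -/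
noncomputable def covXGivenYZ (P : Measure (Triple nx ny nz)) : Matrix (Fin nx) (Fin nx) ℝ :=
  errCov P (fun t => t.1) (fun t => (t.2.1, t.2.2))

/-- An auxiliary random vector `u ∈ ℝᵐ` for the source law `P`, given by the joint law of
`((x, y, z), u)`: the triple `(x, y, z)` has law `P`, and `u ↔ y ↔ (x, z)` is a Markov chain, that is,
`u` and `(x, z)` are conditionally independent given `y`. -/
structure Auxiliary (P : Measure (Triple nx ny nz)) (m : ℕ) where
  law : Measure (Triple nx ny nz × EuclideanSpace ℝ (Fin m))
  isProb : IsProbabilityMeasure law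
  marginal : law.map Prod.fst = P
  markov : CondIndepFun
    (MeasurableSpace.comap
      (fun q : Triple nx ny nz × EuclideanSpace ℝ (Fin m) => q.1.2.1) inferInstance)
    (Measurable.comap_le (by fun_prop))
    (fun q : Triple nx ny nz × EuclideanSpace ℝ (Fin m) => q.2)
    (fun q : Triple nx ny nz × EuclideanSpace ℝ (Fin m) => (q.1.1, q.1.2.2)) law

attribute [instance] Auxiliary.isProb

/-- `Σ_{x|uz}`. -/
noncomputable def Auxiliary.errCov {P : Measure (Triple nx ny nz)} {m : ℕ} (a : Auxiliary P m) :
    Matrix (Fin nx) (Fin nx) ℝ :=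
  RemoteWynerZiv.errCov a.law (fun q => q.1.1) (fun q => (q.2, q.1.2.2))

/-- `I(y; u | z)`. -/
noncomputable def Auxiliary.rate {P : Measure (Triple nx ny nz)} {m : ℕ} (a : Auxiliary P m) :
    ℝ≥0∞ :=
  condMutualInfo a.law (fun q => q.1.2.1) (fun q => q.2) (fun q => q.1.2.2)

/-- The values of `I(y; u | z)` over all auxiliary vectors `u` with `u ↔ y ↔ (x, z)` that meet the
covariance matrix distortion constraint `Σ_{x|uz} ⪯ 𝐃`. -/
def covRates (P : Measure (Triple nx ny nz)) (DD : Matrix (Fin nx) (Fin nx) ℝ) : Set ℝ≥0∞ :=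
  {r | ∃ (m : ℕ) (a : Auxiliary P m), (DD - a.errCov).PosSemidef ∧ a.rate = r}

/-- The values of `I(y; u | z)` over all auxiliary vectors `u` with `u ↔ y ↔ (x, z)` that meet the
mean-squared error constraint `tr Σ_{x|uz} ≤ nx D`. -/
def mseRates (P : Measure (Triple nx ny nz)) (D : ℝ) : Set ℝ≥0∞ :=
  {r | ∃ (m : ℕ) (a : Auxiliary P m), a.errCov.trace ≤ nx * D ∧ a.rate = r}

/-- The rate-distortion function under the covariance matrix distortion constraint. -/
noncomputable def rdfCov (P : Measure (Triple nx ny nz)) (DD : Matrix (Fin nx) (Fin nx) ℝ) :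
    ℝ≥0∞ :=
  sInf (covRates P DD)

/-- The rate-distortion function under the mean-squared error constraint. -/
noncomputable def rdfMSE (P : Measure (Triple nx ny nz)) (D : ℝ) : ℝ≥0∞ :=
  sInf (mseRates P D)

/-- The closed form `½ log (|Σ_{x|z} - Σ_{x|yz}| / |min(𝐃 - Σ_{x|yz}, Σ_{x|z} - Σ_{x|yz})|)`. -/
noncomputable def covRateFormula (P : Measure (Triple nx ny nz))
    (DD : Matrix (Fin nx) (Fin nx) ℝ) : ℝ :=
  1 / 2 * Real.log ((covXGivenZ P - covXGivenYZ P).det /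
    (matrixMin (DD - covXGivenYZ P) (covXGivenZ P - covXGivenYZ P)).det)

/-- `lam` is a water level: `∑ᵢ min(lam, λᵢ) = nx D - tr Σ_{x|yz}`. -/
def IsWaterLevel (P : Measure (Triple nx ny nz)) (D : ℝ) (l : Fin nx → ℝ) (lam : ℝ) : Prop :=
  ∑ i, min lam (l i) = nx * D - (covXGivenYZ P).trace

/-- The water-filling distortion matrix `𝐃* = Σ_{x|yz} + Uᵀ diag(min(lam, λᵢ)) U`. -/
noncomputable def waterFillingMatrix (P : Measure (Triple nx ny nz))
    (U : Matrix (Fin nx) (Fin nx) ℝ) (l : Fin nx → ℝ) (lam : ℝ) : Matrix (Fin nx) (Fin nx) ℝ :=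
  covXGivenYZ P + Uᵀ * Matrix.diagonal (fun i => min lam (l i)) * U

end Problem

end RemoteWynerZiv

/-!
The distortion matrix `𝐃*` has trace `nx D`, by the definition of the water level, so every auxiliary
vector that meets the covariance constraint `Σ_{x|uz} ⪯ 𝐃*` meets the mean-squared error constraint.
Both minima are therefore equal to `½ ∑ log (lᵢ / mᵢ)`, `mᵢ = min(lam, lᵢ)`, as soon as this number
is a lower bound for the rate under the *weaker* constraint (`Auxiliary.le_rate`) and is attained
by an auxiliary vector with `Σ_{x|uz} = 𝐃*` (`Innovations.gaussianAux`).

Both parts rest on the decomposition `x = e + w + G z` (`Innovations`): the error `e` is independent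
of `(y, z)`, and the innovation `w`, a linear function of `(y, z)`, is independent of `z` and has the
covariance matrix `Σ_{x|z} - Σ_{x|yz} = Uᵀ diag(l) U`. So `U w` has independent Gaussian coordinates
of variance `lᵢ`.

*Lower bound.* By the Markov property `e` is also independent of `(y, z, u)`, so that the error of
`E[x|u,z]` is the sum of `e` and of the error of an estimate `h(z, u)` of `w`; the constraint on
the trace says that the error variances `sᵢ` of `U h` as an estimate of `U w` have sum at most `∑ mᵢ`.
By data processing `I(y; u | z)` is at least the divergence of the joint law of `((z, u), U w)` from
the product of its marginals (`klDiv_le_condMutualInfo`; here the independence of `w` and `z`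
enters). This divergence is bounded below by the Donsker-Varadhan inequality, with the logarithm of the
density of `N(U h, diag(m))` with respect to `N(0, diag(l))` as the test function
(`le_klDiv_prod_piGaussian`). The result is `½ ∑ log (lᵢ / mᵢ) + ½ ∑ (1 - sᵢ / mᵢ)`, and the last sum is
nonnegative by the optimality of water-filling (`sum_div_min_le`). No matrix inequality between error
covariances and no entropy of `u` is needed.

*Attainment.* Let `u` be the part of `a U w` that depends on `y`, plus standard Gaussian noise, with
`aᵢ² = 1 / mᵢ - 1 / lᵢ`. Together with `z`, it determines `v = a U w + n`, which is independent of
`z`; the estimate of `U w` from `v` has error covariance `diag(m)` (`gaussian_testChannel`), and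
`I(y; u | z)` is the divergence of the joint law of `((z, y), v)` from the product of its marginals,
which is that of an additive Gaussian noise channel (`klDiv_map_add_noise`).

The closed form follows since `𝐃* - Σ_{x|yz} ⪯ Σ_{x|z} - Σ_{x|yz}` have the common eigenbasis `U`, and
the minimum of an ordered pair of matrices is the smaller one (`matrixMin_eq_left`).
-/

namespace RemoteWynerZiv


/-! ### Product Gaussian measures with diagonal covariance -/

section GaussianProduct

variable {ι : Type*} [Fintype ι]

/-- The Gaussian measure on `ℝ^ι` with independent coordinates of mean `c i` and variance `v i`. -/
noncomputable def piGaussian (c v : ι → ℝ) : Measure (ι → ℝ) :=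
  Measure.pi fun i => gaussianReal (c i) (v i).toNNReal

instance (c v : ι → ℝ) : IsProbabilityMeasure (piGaussian c v) := by
  unfold piGaussian; infer_instance

/-- The logarithm of the density of `piGaussian c v` with respect to `piGaussian 0 v'`. -/
noncomputable def gaussianLLR (v v' c x : ι → ℝ) : ℝ :=
  ∑ i, (1 / 2 * Real.log (v' i / v i) - (x i - c i) ^ 2 / (2 * v i) + x i ^ 2 / (2 * v' i))

lemma measurable_gaussianLLR {α : Type*} [MeasurableSpace α] (v v' : ι → ℝ) {f g : α → ι → ℝ}
    (hf : Measurable f) (hg : Measurable g) :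
    Measurable fun a => gaussianLLR v v' (f a) (g a) := by
  unfold gaussianLLR
  fun_prop

lemma pi_withDensity {μ : ι → Measure ℝ} [∀ i, IsProbabilityMeasure (μ i)]
    {f : ι → ℝ → ℝ≥0∞} (hf : ∀ i, Measurable (f i))
    [∀ i, SigmaFinite ((μ i).withDensity (f i))] :
    Measure.pi (fun i => (μ i).withDensity (f i)) =
      (Measure.pi μ).withDensity (fun x => ∏ i, f i (x i)) := by
  refine Measure.pi_eq fun s hs => ?_
  rw [withDensity_apply _ (MeasurableSet.univ_pi hs), ← lintegral_indicator (.univ_pi hs)]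
  have h1 : (Set.univ.pi s).indicator (fun x : ι → ℝ => ∏ i, f i (x i)) =
      fun x => ∏ i, (s i).indicator (f i) (x i) := by
    ext x
    by_cases hx : x ∈ Set.univ.pi s
    · rw [Set.indicator_of_mem hx]
      exact Finset.prod_congr rfl fun i _ => by
        rw [Set.indicator_of_mem (hx i (Set.mem_univ i))]
    · rw [Set.indicator_of_notMem hx]
      obtain ⟨i, hi⟩ : ∃ i, x i ∉ s i := by simpa [Set.mem_pi] using hx
      exact (Finset.prod_eq_zero (Finset.mem_univ i) (Set.indicator_of_notMem hi _)).symm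
  have hm : ∀ i, Measurable ((s i).indicator (f i)) := fun i => (hf i).indicator (hs i)
  rw [h1, lintegral_prod_eq_prod_lintegral_of_indepFun Finset.univ
    (fun i (x : ι → ℝ) => (s i).indicator (f i) (x i)) (iIndepFun_pi fun i => (hm i).aemeasurable)
    (fun i => (hm i).comp (measurable_pi_apply i))]
  refine Finset.prod_congr rfl fun i _ => ?_
  rw [withDensity_apply _ (hs i), ← lintegral_indicator (hs i)]
  have := (measurePreserving_eval μ i).lintegral_comp (hm i)
  simpa using this

lemma gaussianReal_eq_withDensity (c : ℝ) {v v' : ℝ} (hv : 0 < v) (hv' : 0 < v') :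
    gaussianReal c v.toNNReal = (gaussianReal 0 v'.toNNReal).withDensity (fun x =>
      ENNReal.ofReal (Real.exp
        (1 / 2 * Real.log (v' / v) - (x - c) ^ 2 / (2 * v) + x ^ 2 / (2 * v')))) := by
  have h0 : v.toNNReal ≠ 0 := by simpa using hv
  have h0' : v'.toNNReal ≠ 0 := by simpa using hv'
  rw [gaussianReal_of_var_ne_zero _ h0, gaussianReal_of_var_ne_zero _ h0',
    ← withDensity_mul _ (measurable_gaussianPDF _ _) (by fun_prop)]
  congr 1
  ext x
  rw [Pi.mul_apply, gaussianPDF, gaussianPDF, ← ENNReal.ofReal_mul (gaussianPDFReal_nonneg _ _ _)]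
  congr 1
  rw [gaussianPDFReal, gaussianPDFReal, Real.coe_toNNReal _ hv.le, Real.coe_toNNReal _ hv'.le,
    Real.exp_add, sub_eq_add_neg (1 / 2 * Real.log (v' / v)), Real.exp_add]
  have h2 : Real.exp (1 / 2 * Real.log (v' / v)) = √v' / √v := by
    rw [← Real.sqrt_div hv'.le, Real.sqrt_eq_rpow, Real.rpow_def_of_pos (by positivity), mul_comm]
  have h3 : √(2 * Real.pi * v) = √(2 * Real.pi) * √v := Real.sqrt_mul (by positivity) _
  have h4 : √(2 * Real.pi * v') = √(2 * Real.pi) * √v' := Real.sqrt_mul (by positivity) _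
  have h5 : Real.exp (-(x - 0) ^ 2 / (2 * v')) * Real.exp (x ^ 2 / (2 * v')) = 1 := by
    rw [← Real.exp_add]; simp [neg_div]
  have h6 : √v' ≠ 0 := (Real.sqrt_pos.2 hv').ne'
  have h7 : √v ≠ 0 := (Real.sqrt_pos.2 hv).ne'
  have h8 : √(2 * Real.pi) ≠ 0 := (Real.sqrt_pos.2 (by positivity)).ne'
  rw [h2, h3, h4, neg_div]
  calc _ = (√(2 * Real.pi) * √v)⁻¹ * Real.exp (-((x - c) ^ 2 / (2 * v))) * 1 := by ring
    _ = _ := by rw [← h5]; field_simp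

lemma piGaussian_eq_withDensity {v v' : ι → ℝ} (hv : ∀ i, 0 < v i) (hv' : ∀ i, 0 < v' i)
    (c : ι → ℝ) :
    piGaussian c v = (piGaussian 0 v').withDensity
      (fun x => ENNReal.ofReal (Real.exp (gaussianLLR v v' c x))) := by
  have h (i : ι) := gaussianReal_eq_withDensity (c i) (hv i) (hv' i)
  unfold piGaussian
  have : ∀ i, SigmaFinite ((gaussianReal 0 (v' i).toNNReal).withDensity (fun x =>
      ENNReal.ofReal (Real.exp (1 / 2 * Real.log (v' i / v i) - (x - c i) ^ 2 / (2 * v i)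
        + x ^ 2 / (2 * v' i))))) := fun i => by
    rw [← h i]; infer_instance
  simp_rw [h]
  rw [pi_withDensity (fun i => by fun_prop)]
  congr 1
  ext x
  rw [gaussianLLR, Real.exp_sum, ENNReal.ofReal_prod_of_nonneg fun i _ => (Real.exp_pos _).le]

lemma piGaussian_map_add (c v h : ι → ℝ) :
    (piGaussian c v).map (fun x => h + x) = piGaussian (h + c) v := by
  unfold piGaussian
  rw [show (fun x : ι → ℝ => h + x) = fun x i => (fun t => h i + t) (x i) from rfl,
    Measure.pi_map_pi (fun i => by fun_prop)]
  congr 1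
  ext1 i
  rw [gaussianReal_map_const_add, Pi.add_apply, add_comm]

/-- A centred Gaussian vector whose covariance matrix is diagonal has independent coordinates. -/
lemma map_eq_piGaussian {Ω : Type*} [MeasurableSpace Ω] {P : Measure Ω} {X : Ω → ι → ℝ}
    {s : ι → ℝ} (hX : HasGaussianLaw X P) (hmean : ∀ i, ∫ ω, X ω i ∂P = 0)
    (hcov : ∀ i j, i ≠ j → ∫ ω, X ω i * X ω j ∂P = 0) (hvar : ∀ i, ∫ ω, X ω i ^ 2 ∂P = s i) :
    P.map X = piGaussian 0 s := by
  have hP := hX.isProbabilityMeasure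
  have hXi : ∀ i, HasGaussianLaw (fun ω => X ω i) P := fun i => hX.eval (X := fun i ω => X ω i) i
  have hL : ∀ i, MemLp (fun ω => X ω i) 2 P := fun i => (hXi i).memLp_two
  have hind : iIndepFun (fun i ω => X ω i) P := by
    refine HasGaussianLaw.iIndepFun_of_covariance_eq_zero hX fun i j hij => ?_
    rw [covariance_eq_sub (hL i) (hL j), hmean i]
    simpa using hcov i j hij
  have h1 := (iIndepFun_iff_map_fun_eq_pi_map fun i => (hXi i).aemeasurable).1 hind
  rw [show X = fun ω i => X ω i from rfl, h1]
  unfold piGaussian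
  congr 1
  ext1 i
  rw [(hXi i).map_eq_gaussianReal, hmean i, variance_eq_sub (hL i), hmean i]
  simp [hvar i]

end GaussianProduct

/-! ### Kullback-Leibler divergence from a product with a Gaussian factor -/

section GaussianKL

variable {ι : Type*} [Fintype ι] {α : Type*} [MeasurableSpace α]

lemma lintegral_exp_gaussianLLR (S : Measure α) [IsProbabilityMeasure S] {v v' : ι → ℝ}
    (hv : ∀ i, 0 < v i) (hv' : ∀ i, 0 < v' i) {h : α → ι → ℝ} (hh : Measurable h) 
    {g : α × (ι → ℝ) → ℝ≥0∞} (hg : Measurable g) :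
    ∫⁻ p, ENNReal.ofReal (Real.exp (gaussianLLR v v' (h p.1) p.2)) * g p
      ∂(S.prod (piGaussian 0 v')) = ∫⁻ s, ∫⁻ x, g (s, x) ∂(piGaussian (h s) v) ∂S := by
  have hm : Measurable fun p : α × (ι → ℝ) =>
      ENNReal.ofReal (Real.exp (gaussianLLR v v' (h p.1) p.2)) :=
    (measurable_gaussianLLR v v' (hh.comp measurable_fst) measurable_snd).exp.ennreal_ofReal
  rw [lintegral_prod _ (by exact (hm.mul hg).aemeasurable)]
  refine lintegral_congr fun s => ?_
  rw [piGaussian_eq_withDensity hv hv', lintegral_withDensity_eq_lintegral_mul]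
  · rfl
  · exact (measurable_gaussianLLR v v' measurable_const measurable_id).exp.ennreal_ofReal
  · exact hg.comp measurable_prodMk_left

lemma integrable_exp_gaussianLLR (S : Measure α) [IsProbabilityMeasure S] {v v' : ι → ℝ}
    (hv : ∀ i, 0 < v i) (hv' : ∀ i, 0 < v' i) {h : α → ι → ℝ} (hh : Measurable h) :
    Integrable (fun p : α × (ι → ℝ) => Real.exp (gaussianLLR v v' (h p.1) p.2))
      (S.prod (piGaussian 0 v')) ∧
    ∫ p, Real.exp (gaussianLLR v v' (h p.1) p.2) ∂(S.prod (piGaussian 0 v')) = 1 := by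
  have hm : Measurable fun p : α × (ι → ℝ) => Real.exp (gaussianLLR v v' (h p.1) p.2) :=
    (measurable_gaussianLLR v v' (hh.comp measurable_fst) measurable_snd).exp
  have h1 : ∫⁻ p, ENNReal.ofReal (Real.exp (gaussianLLR v v' (h p.1) p.2))
      ∂(S.prod (piGaussian 0 v')) = 1 := by
    simpa using lintegral_exp_gaussianLLR S hv hv' hh (measurable_const (a := (1 : ℝ≥0∞)))
  constructor
  · refine ⟨hm.aestronglyMeasurable, ?_⟩
    rw [hasFiniteIntegral_iff_ofReal (Filter.Eventually.of_forall fun _ => (Real.exp_pos _).le), h1]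
    exact ENNReal.one_lt_top
  · rw [integral_eq_lintegral_of_nonneg_ae (Filter.Eventually.of_forall
      fun _ => (Real.exp_pos _).le) hm.aestronglyMeasurable, h1, ENNReal.toReal_one]

/-- The Donsker-Varadhan bound for the divergence from a product `S ⊗ N(0, v')`, tested
against the log-likelihood ratio of a Gaussian with variances `v` and mean `h s`. -/
lemma le_klDiv_prod_piGaussian (S : Measure α) [IsProbabilityMeasure S] {v v' : ι → ℝ}
    (hv : ∀ i, 0 < v i) (hv' : ∀ i, 0 < v' i) {h : α → ι → ℝ} (hh : Measurable h)
    (ρ : Measure (α × (ι → ℝ))) [IsProbabilityMeasure ρ]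
    (hint : Integrable (fun p => gaussianLLR v v' (h p.1) p.2) ρ) :
    ENNReal.ofReal (∫ p, gaussianLLR v v' (h p.1) p.2 ∂ρ) ≤
      klDiv ρ (S.prod (piGaussian 0 v')) := by
  obtain ⟨he, he1⟩ := integrable_exp_gaussianLLR S hv hv' hh
  set ν := S.prod (piGaussian 0 v')
  by_cases hk : klDiv ρ ν = ∞
  · rw [hk]; exact le_top
  obtain ⟨hac, hll⟩ := klDiv_ne_top_iff.1 hk
  have h2 := integral_llr_tilted_right hac hint he hll
  have hp : IsProbabilityMeasure (ν.tilted fun p => gaussianLLR v v' (h p.1) p.2) :=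
    isProbabilityMeasure_tilted he
  have h3 := integral_llr_add_sub_measure_univ_nonneg
    (hac.trans (absolutelyContinuous_tilted he)) (integrable_llr_tilted_right hac hint hll he)
  rw [h2, he1] at h3
  rw [klDiv_of_ac_of_integrable hac hll]
  refine ENNReal.ofReal_le_ofReal ?_
  simp at h3 ⊢
  linarith

/-- The divergence of the law of `(s, h s + N)`, with `N` Gaussian noise independent of `s`,
from the product `S ⊗ N(0, v')`. -/
lemma klDiv_map_add_noise (S : Measure α) [IsProbabilityMeasure S] {v v' : ι → ℝ}
    (hv : ∀ i, 0 < v i) (hv' : ∀ i, 0 < v' i) {h : α → ι → ℝ} (hh : Measurable h)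
    (hint : Integrable (fun p : α × (ι → ℝ) => gaussianLLR v v' (h p.1) (h p.1 + p.2))
      (S.prod (piGaussian 0 v))) :
    klDiv ((S.prod (piGaussian 0 v)).map fun p => (p.1, h p.1 + p.2))
      (S.prod (piGaussian 0 v')) =
    ENNReal.ofReal (∫ p, gaussianLLR v v' (h p.1) (h p.1 + p.2) ∂(S.prod (piGaussian 0 v))) := by
  obtain ⟨he, he1⟩ := integrable_exp_gaussianLLR S hv hv' hh
  set ν := S.prod (piGaussian 0 v')
  set f : α × (ι → ℝ) → ℝ := fun p => gaussianLLR v v' (h p.1) p.2 with hf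
  have hfm : Measurable f := measurable_gaussianLLR v v' (hh.comp measurable_fst) measurable_snd
  have hΦ : Measurable fun p : α × (ι → ℝ) => (p.1, h p.1 + p.2) :=
    measurable_fst.prodMk ((hh.comp measurable_fst).add measurable_snd)
  set ρ := (S.prod (piGaussian 0 v)).map fun p => (p.1, h p.1 + p.2) with hρ
  have : IsProbabilityMeasure ρ := Measure.isProbabilityMeasure_map hΦ.aemeasurable
  have heq : ρ = ν.tilted f := by
    refine Measure.ext fun B hB => ?_
    have h1 := lintegral_exp_gaussianLLR S hv hv' hh (measurable_const.indicator hB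
      (f := fun _ => (1 : ℝ≥0∞)))
    rw [tilted_apply' _ _ hB, he1, ← lintegral_indicator hB]
    simp only [div_one]
    calc ρ B = ∫⁻ p, B.indicator (fun _ => 1) p ∂ρ := by simp [lintegral_indicator hB]
      _ = ∫⁻ s, ∫⁻ x, B.indicator (fun _ => 1) (s, h s + x) ∂(piGaussian 0 v) ∂S := by
        rw [hρ, lintegral_map (measurable_const.indicator hB) hΦ, lintegral_prod]
        exact ((measurable_const.indicator hB).comp hΦ).aemeasurable
      _ = ∫⁻ s, ∫⁻ x, B.indicator (fun _ => 1) (s, x) ∂(piGaussian (h s) v) ∂S := by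
        refine lintegral_congr fun s => ?_
        rw [← add_zero (h s), ← piGaussian_map_add, lintegral_map _ (by fun_prop)]
        · simp
        · exact (measurable_const.indicator hB).comp measurable_prodMk_left
      _ = _ := by
        rw [← h1]
        refine lintegral_congr fun p => ?_
        by_cases hp : p ∈ B <;> simp [hp, hf]
  have hfρ : Integrable f ρ := by
    rw [hρ, integrable_map_measure hfm.aestronglyMeasurable hΦ.aemeasurable]
    exact hint
  have hac : ρ ≪ ν := by rw [heq]; exact tilted_absolutelyContinuous ν f
  have hllr : llr ρ ν =ᵐ[ρ] f := by
    refine hac.ae_le ?_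
    rw [heq]
    have := log_rnDeriv_tilted_left_self he
    rw [he1] at this
    filter_upwards [this] with x hx
    simpa [llr] using hx
  rw [klDiv_of_ac_of_integrable hac ((integrable_congr hllr).2 hfρ), integral_congr_ae hllr, hρ,
    integral_map hΦ.aemeasurable hfm.aestronglyMeasurable, ← hρ]
  simp [hf]

end GaussianKL


/-! ### Conditional mutual information and independence of the side information -/

section CondMutualInfo

variable {Ω α β γ δ : Type*} [MeasurableSpace Ω] [MeasurableSpace α] [StandardBorelSpace α]
  [Nonempty α] [MeasurableSpace β] [StandardBorelSpace β] [Nonempty β] [MeasurableSpace γ]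
  [MeasurableSpace δ] {μ : Measure Ω} {y : Ω → α} {u : Ω → β} {z : Ω → γ}
  {φ : γ × β → δ}

lemma condDistrib_preimage_of_indepFun [IsProbabilityMeasure μ] (hu : Measurable u)
    (hz : Measurable z) (hφ : Measurable φ) (hind : IndepFun z (fun ω => φ (z ω, u ω)) μ)
    {C : Set δ} (hC : MeasurableSet C) :
    ∀ᵐ a ∂(μ.map z), condDistrib u z μ a (Prod.mk a ⁻¹' (φ ⁻¹' C)) =
      μ.map (fun ω => φ (z ω, u ω)) C := by
  have hzu : Measurable fun ω => φ (z ω, u ω) := hφ.comp (hz.prodMk hu)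
  refine ae_eq_of_forall_setLIntegral_eq_of_sigmaFinite
    (Kernel.measurable_kernel_prodMk_left (hφ hC)) measurable_const fun A hA _ => ?_
  have h1 : (μ.map z ⊗ₘ condDistrib u z μ) (Prod.fst ⁻¹' A ∩ φ ⁻¹' C) =
      ∫⁻ a in A, condDistrib u z μ a (Prod.mk a ⁻¹' (φ ⁻¹' C)) ∂(μ.map z) := by
    rw [Measure.compProd_apply ((measurable_fst hA).inter (hφ hC)), ← lintegral_indicator hA]
    refine lintegral_congr fun a => ?_
    by_cases ha : a ∈ A <;> simp [ha, Set.preimage_preimage]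
  rw [← h1, compProd_map_condDistrib hu.aemeasurable, setLIntegral_const,
    Measure.map_apply (hz.prodMk hu) ((measurable_fst hA).inter (hφ hC)),
    Measure.map_apply hzu hC, Measure.map_apply hz hA]
  rw [mul_comm, ← hind.measure_inter_preimage_eq_mul _ _ hA hC]
  rfl

/-- If `φ (z, u)` is independent of `z`, then under the law that makes `y` and `u` conditionally
independent given `z` it is independent of the pair `(z, y)`. -/
lemma compProd_condDistrib_map [IsProbabilityMeasure μ] (hy : Measurable y) (hu : Measurable u)
    (hz : Measurable z) (hφ : Measurable φ) (hind : IndepFun z (fun ω => φ (z ω, u ω)) μ) :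
    (μ.map z ⊗ₘ (condDistrib y z μ ×ₖ condDistrib u z μ)).map
      (fun p => ((p.1, p.2.1), φ (p.1, p.2.2))) =
    (μ.map fun ω => (z ω, y ω)).prod (μ.map fun ω => φ (z ω, u ω)) := by
  have hzu : Measurable fun ω => φ (z ω, u ω) := hφ.comp (hz.prodMk hu)
  have hΦ : Measurable fun p : γ × α × β => ((p.1, p.2.1), φ (p.1, p.2.2)) := by fun_prop
  have := Measure.isProbabilityMeasure_map (μ := μ) hz.aemeasurable
  have := Measure.isProbabilityMeasure_map (μ := μ) (hz.prodMk hy).aemeasurable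
  have := Measure.isProbabilityMeasure_map (μ := μ) hzu.aemeasurable
  have := Measure.isProbabilityMeasure_map
    (μ := μ.map z ⊗ₘ (condDistrib y z μ ×ₖ condDistrib u z μ)) hΦ.aemeasurable
  refine Measure.ext_prod₃_iff'.2 fun {A B C} hA hB hC => ?_
  rw [Measure.map_apply hΦ ((hA.prod hB).prod hC), Measure.prod_prod,
    Measure.compProd_apply (hΦ ((hA.prod hB).prod hC)),
    ← compProd_map_condDistrib hy.aemeasurable, Measure.compProd_apply (hA.prod hB), mul_comm,
    ← lintegral_const_mul _ (Kernel.measurable_kernel_prodMk_left (hA.prod hB))]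
  refine lintegral_congr_ae ?_
  filter_upwards [condDistrib_preimage_of_indepFun hu hz hφ hind hC] with a ha
  rw [← ha]
  by_cases haA : a ∈ A
  · rw [show Prod.mk a ⁻¹' ((fun p : γ × α × β => ((p.1, p.2.1), φ (p.1, p.2.2))) ⁻¹'
      ((A ×ˢ B) ×ˢ C)) = B ×ˢ (Prod.mk a ⁻¹' (φ ⁻¹' C)) by ext; simp [haA], Kernel.prod_apply,
      Measure.prod_prod, mul_comm]
    simp [haA]
  · rw [show Prod.mk a ⁻¹' ((fun p : γ × α × β => ((p.1, p.2.1), φ (p.1, p.2.2))) ⁻¹'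
      ((A ×ˢ B) ×ˢ C)) = ∅ by ext; simp [haA], measure_empty]
    simp [haA]

lemma klDiv_le_condMutualInfo [IsProbabilityMeasure μ] (hy : Measurable y) (hu : Measurable u)
    (hz : Measurable z) (hφ : Measurable φ) (hind : IndepFun z (fun ω => φ (z ω, u ω)) μ) :
    klDiv (μ.map fun ω => ((z ω, y ω), φ (z ω, u ω)))
      ((μ.map fun ω => (z ω, y ω)).prod (μ.map fun ω => φ (z ω, u ω))) ≤
    condMutualInfo μ y u z := by
  have hΦ : Measurable fun p : γ × α × β => ((p.1, p.2.1), φ (p.1, p.2.2)) := by fun_prop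
  have := Measure.isProbabilityMeasure_map (μ := μ) hz.aemeasurable
  have h := klDiv_map_le (μ.map fun ω => (z ω, (y ω, u ω)))
    (μ.map z ⊗ₘ (condDistrib y z μ ×ₖ condDistrib u z μ)) hΦ
  rwa [compProd_condDistrib_map hy hu hz hφ hind, Measure.map_map hΦ (by fun_prop)] at h

/-- If moreover `u` can be recovered from `z` and `φ (z, u)`, no information is lost. -/
lemma condMutualInfo_le_klDiv [IsProbabilityMeasure μ] (hy : Measurable y) (hu : Measurable u)
    (hz : Measurable z) (hφ : Measurable φ) (hind : IndepFun z (fun ω => φ (z ω, u ω)) μ)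
    {θ : γ × δ → β} (hθ : Measurable θ) (hθφ : ∀ a b, θ (a, φ (a, b)) = b) :
    condMutualInfo μ y u z ≤ klDiv (μ.map fun ω => ((z ω, y ω), φ (z ω, u ω)))
      ((μ.map fun ω => (z ω, y ω)).prod (μ.map fun ω => φ (z ω, u ω))) := by
  have hΦ : Measurable fun p : γ × α × β => ((p.1, p.2.1), φ (p.1, p.2.2)) := by fun_prop
  have hΘ : Measurable fun p : (γ × α) × δ => (p.1.1, (p.1.2, θ (p.1.1, p.2))) := by fun_prop
  have := Measure.isProbabilityMeasure_map (μ := μ) hz.aemeasurable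
  have h := klDiv_map_le (((μ.map fun ω => (z ω, (y ω, u ω)))).map
      fun p => ((p.1, p.2.1), φ (p.1, p.2.2)))
    ((μ.map z ⊗ₘ (condDistrib y z μ ×ₖ condDistrib u z μ)).map
      fun p => ((p.1, p.2.1), φ (p.1, p.2.2))) hΘ
  rw [Measure.map_map hΘ hΦ, Measure.map_map hΘ hΦ] at h
  rw [compProd_condDistrib_map hy hu hz hφ hind, Measure.map_map hΦ (by fun_prop)] at h
  have hid : (fun p : (γ × α) × δ => (p.1.1, (p.1.2, θ (p.1.1, p.2)))) ∘
      (fun p : γ × α × β => ((p.1, p.2.1), φ (p.1, p.2.2))) = id := by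
    ext p <;> simp [hθφ]
  rw [hid, Measure.map_id, Measure.map_id] at h
  exact h

lemma condMutualInfo_comm_le [IsProbabilityMeasure μ] (hy : Measurable y) (hu : Measurable u)
    (hz : Measurable z) : condMutualInfo μ y u z ≤ condMutualInfo μ u y z := by
  have := Measure.isProbabilityMeasure_map (μ := μ) hz.aemeasurable
  have hs : Measurable (Prod.map (id : γ → γ) (Prod.swap : β × α → α × β)) := by fun_prop
  have h := klDiv_map_le (μ.map fun ω => (z ω, (u ω, y ω)))
    (μ.map z ⊗ₘ (condDistrib u z μ ×ₖ condDistrib y z μ)) hs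
  rwa [Measure.map_map hs (by fun_prop), ← Measure.compProd_map measurable_swap,
    Kernel.map_prod_swap] at h

end CondMutualInfo


/-! ### Linear regression of Gaussian vectors -/

section Regression

variable {Ω : Type*} [MeasurableSpace Ω] {P : Measure Ω} {F : Type*} [NormedAddCommGroup F]
  [NormedSpace ℝ F] [FiniteDimensional ℝ F]

/-- The best linear estimate of a square-integrable `f` from the finite-dimensional vector `Y` is
its projection in `L²` onto the linear functionals of `Y`. -/
lemma exists_dual_orthogonal {Y : Ω → F} (hY : MemLp Y 2 P) {f : Ω → ℝ} (hf : MemLp f 2 P) :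
    ∃ a : StrongDual ℝ F, ∀ b : StrongDual ℝ F, ∫ ω, (f ω - a (Y ω)) * b (Y ω) ∂P = 0 := by
  have hmem : ∀ a : StrongDual ℝ F, MemLp (fun ω => a (Y ω)) 2 P := fun a => a.comp_memLp' hY
  let T : StrongDual ℝ F →ₗ[ℝ] Lp ℝ 2 P :=
    { toFun := fun a => (hmem a).toLp
      map_add' := fun a b => by rw [← MemLp.toLp_add]; rfl
      map_smul' := fun c a => by rw [RingHom.id_apply, ← MemLp.toLp_const_smul]; rfl }
  have : FiniteDimensional ℝ (LinearMap.range T) := inferInstance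
  obtain ⟨a, ha⟩ : (LinearMap.range T).starProjection hf.toLp ∈ LinearMap.range T :=
    Submodule.starProjection_apply_mem _ _
  refine ⟨a, fun b => ?_⟩
  have h1 := (LinearMap.range T).sub_starProjection_mem_orthogonal hf.toLp (T b) ⟨b, rfl⟩
  rw [← ha, L2.inner_def] at h1
  rw [← h1]
  refine integral_congr_ae ?_
  filter_upwards [Lp.coeFn_sub hf.toLp (T a), hf.coeFn_toLp, (hmem a).coeFn_toLp,
    (hmem b).coeFn_toLp] with ω h2 h3 h4 h5
  have h4' : (T a : Ω → ℝ) ω = a (Y ω) := h4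
  have h5' : (T b : Ω → ℝ) ω = b (Y ω) := h5
  rw [h2, Pi.sub_apply, h3, h4', h5']
  simp

/-- A centred Gaussian vector `X` is the sum of a linear function of `Y` and of a vector
independent of `Y`, when `X` and `Y` are jointly Gaussian. -/
lemma exists_regression [MeasurableSpace F] [BorelSpace F] [SecondCountableTopology F] {n : ℕ}
    {X : Ω → EuclideanSpace ℝ (Fin n)} {Y : Ω → F}
    (hXY : HasGaussianLaw (fun ω => (X ω, Y ω)) P)
    (hY : ∫ ω, Y ω ∂P = 0) :
    ∃ L : F →L[ℝ] EuclideanSpace ℝ (Fin n), IndepFun (fun ω => X ω - L (Y ω)) Y P := by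
  have : CompleteSpace F := FiniteDimensional.complete ℝ F
  have hP := hXY.isProbabilityMeasure
  have hX2 : MemLp X 2 P := hXY.fst.memLp_two
  have hY2 : MemLp Y 2 P := hXY.snd.memLp_two
  have hXi : ∀ i, MemLp (fun ω => X ω i) 2 P := fun i =>
    (EuclideanSpace.proj i : EuclideanSpace ℝ (Fin n) →L[ℝ] ℝ).comp_memLp' hX2
  choose a ha using fun i => exists_dual_orthogonal hY2 (hXi i)
  let L : F →L[ℝ] EuclideanSpace ℝ (Fin n) :=
    (PiLp.continuousLinearEquiv 2 ℝ fun _ : Fin n => ℝ).symm.toContinuousLinearMap ∘L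
      ContinuousLinearMap.pi a
  have hL : ∀ v i, L v i = a i v := fun v i => rfl
  refine ⟨L, HasGaussianLaw.indepFun_of_covariance_strongDual ?_ fun L₁ L₂ => ?_⟩
  · exact hXY.map ((ContinuousLinearMap.fst ℝ _ _ - L ∘L ContinuousLinearMap.snd ℝ _ _).prod
      (ContinuousLinearMap.snd ℝ _ _))
  have hL2 : MemLp (fun ω => X ω - L (Y ω)) 2 P := hX2.sub (L.comp_memLp' hY2)
  have hb : MemLp (L₂ ∘ Y) 2 P := L₂.comp_memLp' hY2
  rw [covariance_eq_sub (L₁.comp_memLp' hL2) hb]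
  have hb0 : ∫ ω, (L₂ ∘ Y) ω ∂P = 0 := by
    have := L₂.integral_comp_comm (hY2.integrable (by norm_num))
    rw [hY, map_zero] at this
    exact this
  rw [hb0, mul_zero, sub_zero]
  have hexp : ∀ v : EuclideanSpace ℝ (Fin n),
      L₁ v = ∑ i, v i * L₁ (EuclideanSpace.single i 1) := fun v => by
    conv_lhs => rw [← (EuclideanSpace.basisFun (Fin n) ℝ).sum_repr v]
    simp
  have h1 : ∫ ω, ((L₁ ∘ fun ω => X ω - L (Y ω)) * (L₂ ∘ Y)) ω ∂P =
      ∫ ω, ∑ i, L₁ (EuclideanSpace.single i 1) * ((X ω i - a i (Y ω)) * L₂ (Y ω)) ∂P := by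
    congr 1
    ext ω
    simp only [Pi.mul_apply, Function.comp_apply]
    rw [hexp, Finset.sum_mul]
    refine Finset.sum_congr rfl fun i _ => ?_
    rw [PiLp.sub_apply, hL]
    ring
  rw [h1, integral_finsetSum]
  · refine Finset.sum_eq_zero fun i _ => ?_
    rw [integral_const_mul, ha i L₂, mul_zero]
  · intro i _
    refine Integrable.const_mul ?_ _
    exact MemLp.integrable_mul ((hXi i).sub ((a i).comp_memLp' hY2)) hb

end Regression


/-! ### Independence, Markov chains and additive noise -/

section Independence

variable {Ω Ω' α β γ δ ε : Type*} [MeasurableSpace Ω] [MeasurableSpace Ω'] [MeasurableSpace α]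
  [MeasurableSpace β] [MeasurableSpace γ] [MeasurableSpace δ] [MeasurableSpace ε]
  {μ : Measure Ω}

lemma indepFun_map_iff {Φ : Ω → Ω'} (hΦ : Measurable Φ) {f : Ω' → α} {g : Ω' → β}
    (hf : Measurable f) (hg : Measurable g) :
    IndepFun f g (μ.map Φ) ↔ IndepFun (fun ω => f (Φ ω)) (fun ω => g (Φ ω)) μ := by
  rw [indepFun_iff_measure_inter_preimage_eq_mul, indepFun_iff_measure_inter_preimage_eq_mul]
  refine forall₄_congr fun s t hs ht => ?_
  rw [Measure.map_apply hΦ ((hf hs).inter (hg ht)), Measure.map_apply hΦ (hf hs),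
    Measure.map_apply hΦ (hg ht)]
  rfl

/-- Independence of `X` and `(Y, Z)` may be tested on rectangles of the pair. -/
lemma indepFun_prodMk_of_rect [IsProbabilityMeasure μ] {X : Ω → α} {Y : Ω → β} {Z : Ω → γ}
    (hX : Measurable X) (hY : Measurable Y) (hZ : Measurable Z)
    (h : ∀ A B C, MeasurableSet A → MeasurableSet B → MeasurableSet C →
      μ (X ⁻¹' A ∩ (Y ⁻¹' B ∩ Z ⁻¹' C)) = μ (X ⁻¹' A) * μ (Y ⁻¹' B ∩ Z ⁻¹' C)) :
    IndepFun X (fun ω => (Y ω, Z ω)) μ := by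
  have hYZ : Measurable fun ω => (Y ω, Z ω) := hY.prodMk hZ
  rw [indepFun_iff_map_prod_eq_prod_map_map hX.aemeasurable hYZ.aemeasurable]
  have := Measure.isProbabilityMeasure_map (μ := μ) hX.aemeasurable
  have := Measure.isProbabilityMeasure_map (μ := μ) hYZ.aemeasurable
  have := Measure.isProbabilityMeasure_map (μ := μ) (hX.prodMk hYZ).aemeasurable
  refine Measure.ext_prod₃ fun {A B C} hA hB hC => ?_
  rw [Measure.map_apply (hX.prodMk hYZ) (hA.prod (hB.prod hC)), Measure.prod_prod,
    Measure.map_apply hX hA, Measure.map_apply hYZ (hB.prod hC)]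
  exact h A B C hA hB hC

lemma indepFun_prodMk_right [IsProbabilityMeasure μ] {X : Ω → α} {Y : Ω → β} {Z : Ω → γ}
    (hX : Measurable X) (hY : Measurable Y) (hZ : Measurable Z) (hXY : IndepFun X Y μ)
    (hXYZ : IndepFun (fun ω => (X ω, Y ω)) Z μ) : IndepFun X (fun ω => (Y ω, Z ω)) μ := by
  refine indepFun_prodMk_of_rect hX hY hZ fun A B C hA hB hC => ?_
  have hYZ : IndepFun Y Z μ := hXYZ.comp (φ := Prod.snd) (ψ := id) measurable_snd measurable_id
  have h1 := hXYZ.measure_inter_preimage_eq_mul _ _ (hA.prod hB) hC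
  rw [show (fun ω => (X ω, Y ω)) ⁻¹' (A ×ˢ B) = X ⁻¹' A ∩ Y ⁻¹' B from rfl, Set.inter_assoc,
    hXY.measure_inter_preimage_eq_mul _ _ hA hB, mul_assoc,
    ← hYZ.measure_inter_preimage_eq_mul _ _ hB hC] at h1
  exact h1

/-- Let `u` and `g` be conditionally independent given `k`. If a function `f (k, g)` is independent
of `p (k, g)`, and `k` is a function of the latter, then `f (k, g)` is independent of
`(p (k, g), u)`. -/
lemma indepFun_of_condIndepFun [StandardBorelSpace Ω] [StandardBorelSpace α] [Nonempty α]
    [StandardBorelSpace β] [Nonempty β] [IsProbabilityMeasure μ]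
    {k : Ω → γ} {g : Ω → α} {u : Ω → β} (hk : Measurable k) (hg : Measurable g)
    (hu : Measurable u)
    (hind : CondIndepFun (MeasurableSpace.comap k inferInstance) hk.comap_le u g μ)
    {f : γ × α → δ} {p : γ × α → ε} {q : ε → γ} (hf : Measurable f) (hp : Measurable p)
    (hq : Measurable q) (hqp : ∀ c, q (p c) = c.1)
    (hfp : IndepFun (fun ω => f (k ω, g ω)) (fun ω => p (k ω, g ω)) μ) :
    IndepFun (fun ω => f (k ω, g ω)) (fun ω => (p (k ω, g ω), u ω)) μ := by
  have hkg : Measurable fun ω => (k ω, g ω) := hk.prodMk hg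
  refine indepFun_prodMk_of_rect (hf.comp hkg) (hp.comp hkg) hu fun A B C hA hB hC => ?_
  have h1 := (condIndepFun_iff_condDistrib_prod_ae_eq_prodMkRight hu hg hk).1 hind.symm
  rw [condDistrib_ae_eq_iff_measure_eq_compProd _ hu.aemeasurable] at h1
  -- the law of `u` given `(k, g)` only depends on `k`
  have key : ∀ S : Set (γ × α), MeasurableSet S → μ ((fun ω => (k ω, g ω)) ⁻¹' S ∩ u ⁻¹' C) =
      ∫⁻ ω, S.indicator (fun c => condDistrib u k μ c.1 C) (k ω, g ω) ∂μ := fun S hS => by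
    have h2 : μ ((fun ω => (k ω, g ω)) ⁻¹' S ∩ u ⁻¹' C) =
        (μ.map fun ω => ((k ω, g ω), u ω)) (S ×ˢ C) := by
      rw [Measure.map_apply (hkg.prodMk hu) (hS.prod hC)]
      rfl
    have hm : Measurable fun c : γ × α => condDistrib u k μ c.1 C :=
      (Kernel.measurable_coe _ hC).comp measurable_fst
    rw [h2, h1, Measure.compProd_apply (hS.prod hC),
      lintegral_map (Kernel.measurable_kernel_prodMk_left (hS.prod hC)) hkg]
    refine lintegral_congr fun ω => ?_
    by_cases hω : (k ω, g ω) ∈ S <;> simp [hω]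
  have hm : Measurable fun e : ε => B.indicator (fun e => condDistrib u k μ (q e) C) e :=
    ((Kernel.measurable_coe _ hC).comp hq).indicator hB
  have hmA : Measurable (A.indicator (1 : δ → ℝ≥0∞)) := measurable_one.indicator hA
  have hprod := lintegral_mul_eq_lintegral_mul_lintegral_of_indepFun
    (hmA.comp (hf.comp hkg)) (hm.comp (hp.comp hkg)) (hfp.comp hmA hm)
  have e1 : ∫⁻ ω, A.indicator (1 : δ → ℝ≥0∞) (f (k ω, g ω)) ∂μ =
      μ ((fun ω => f (k ω, g ω)) ⁻¹' A) :=
    lintegral_indicator_one ((hf.comp hkg) hA)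
  have e2 := key (p ⁻¹' B) (hp hB)
  have e3 := key (f ⁻¹' A ∩ p ⁻¹' B) ((hf hA).inter (hp hB))
  have e4 : μ ((fun ω => f (k ω, g ω)) ⁻¹' A ∩ ((fun ω => p (k ω, g ω)) ⁻¹' B ∩ u ⁻¹' C)) =
      μ ((fun ω => (k ω, g ω)) ⁻¹' (f ⁻¹' A ∩ p ⁻¹' B) ∩ u ⁻¹' C) := by
    rw [← Set.inter_assoc]
    rfl
  have e5 : μ ((fun ω => p (k ω, g ω)) ⁻¹' B ∩ u ⁻¹' C) =
      ∫⁻ ω, B.indicator (fun e => condDistrib u k μ (q e) C) (p (k ω, g ω)) ∂μ := by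
    refine e2.trans (lintegral_congr fun ω => ?_)
    by_cases hω : p (k ω, g ω) ∈ B <;> simp [hω, hqp]
  rw [e4, e3, e5, ← e1]
  refine Eq.trans (lintegral_congr fun ω => ?_) hprod
  by_cases hA' : f (k ω, g ω) ∈ A <;> by_cases hB' : p (k ω, g ω) ∈ B <;> simp [hA', hB', hqp]

/-- A function `ψ (k, N)` of `k` and of noise independent of everything is conditionally
independent of `g` given `k`. -/
lemma condIndepFun_of_noise [StandardBorelSpace Ω] [StandardBorelSpace α] [Nonempty α]
    [StandardBorelSpace β] [Nonempty β] [IsProbabilityMeasure μ] {ν : Measure δ}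
    [IsProbabilityMeasure ν] {k : Ω → γ} {g : Ω → α} {u : Ω → β} (hk : Measurable k)
    (hg : Measurable g) (hu : Measurable u) {ψ : γ × δ → β} (hψ : Measurable ψ)
    (hlaw : μ.map (fun ω => ((k ω, g ω), u ω)) =
      ((μ.map fun ω => (k ω, g ω)).prod ν).map fun p => (p.1, ψ (p.1.1, p.2))) :
    CondIndepFun (MeasurableSpace.comap k inferInstance) hk.comap_le u g μ := by
  have hkg : Measurable fun ω => (k ω, g ω) := hk.prodMk hg
  have := Measure.isProbabilityMeasure_map (μ := μ) hkg.aemeasurable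
  have := Measure.isProbabilityMeasure_map (μ := μ) hk.aemeasurable
  let κ : Kernel γ β := (Kernel.id ×ₖ Kernel.const γ ν).map ψ
  have hκM : IsMarkovKernel κ := Kernel.IsMarkovKernel.map _ hψ
  have hκ : ∀ c (C : Set β), MeasurableSet C → κ c C = ν {n | ψ (c, n) ∈ C} := fun c C hC => by
    rw [Kernel.map_apply' _ hψ _ hC, Kernel.prod_apply, Kernel.id_apply, Kernel.const_apply,
      Measure.prod_apply (hψ hC), lintegral_dirac' _ (measurable_measure_prodMk_left (hψ hC))]
    rfl
  have hm : Measurable fun p : (γ × α) × δ => (p.1, ψ (p.1.1, p.2)) := by fun_prop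
  have h1 : μ.map (fun ω => ((k ω, g ω), u ω)) =
      (μ.map fun ω => (k ω, g ω)) ⊗ₘ κ.prodMkRight α := by
    rw [hlaw]
    refine Measure.ext fun S hS => ?_
    rw [Measure.map_apply hm hS, Measure.prod_apply (hm hS), Measure.compProd_apply hS]
    refine lintegral_congr fun c => ?_
    rw [Kernel.prodMkRight_apply', hκ _ _ (measurable_prodMk_left hS)]
    rfl
  have h2 : μ.map (fun ω => (k ω, u ω)) = μ.map k ⊗ₘ κ := by
    have hm' : Measurable fun p : (γ × α) × β => (p.1.1, p.2) := by fun_prop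
    have h3 : μ.map (fun ω => (k ω, u ω)) =
        (μ.map (fun ω => ((k ω, g ω), u ω))).map fun p => (p.1.1, p.2) := by
      rw [Measure.map_map hm' (hkg.prodMk hu)]
      rfl
    rw [h3, h1]
    refine Measure.ext fun S hS => ?_
    rw [Measure.map_apply hm' hS, Measure.compProd_apply (hm' hS), Measure.compProd_apply hS,
      lintegral_map (Kernel.measurable_kernel_prodMk_left (hm' hS)) hkg,
      lintegral_map (Kernel.measurable_kernel_prodMk_left hS) hk]
    rfl
  refine ((condIndepFun_iff_condDistrib_prod_ae_eq_prodMkRight hu hg hk).2 ?_).symm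
  have h4 := condDistrib_ae_eq_of_measure_eq_compProd (fun ω => (k ω, g ω)) hu.aemeasurable h1
  have h5 := condDistrib_ae_eq_of_measure_eq_compProd k hu.aemeasurable h2
  have h6 : ∀ᵐ c ∂(μ.map fun ω => (k ω, g ω)), condDistrib u k μ c.1 = κ c.1 := by
    have h7 : μ.map k = (μ.map fun ω => (k ω, g ω)).map Prod.fst := by
      rw [Measure.map_map measurable_fst hkg]; rfl
    rw [h7] at h5
    exact ae_of_ae_map measurable_fst.aemeasurable h5
  filter_upwards [h4, h6] with c hc1 hc2
  rw [hc1, Kernel.prodMkRight_apply, Kernel.prodMkRight_apply, hc2]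

end Independence

/-! ### Error covariances and second moments -/

section SecondMoments

variable {Ω β : Type*} [MeasurableSpace Ω] [MeasurableSpace β] {μ : Measure Ω} {n : ℕ}

lemma errCov_eq_integral {x : Ω → EuclideanSpace ℝ (Fin n)} {w : Ω → β}
    {r : Ω → EuclideanSpace ℝ (Fin n)}
    (h : ∀ i, μ[fun ω => x ω i | MeasurableSpace.comap w inferInstance] =ᵐ[μ]
      fun ω => x ω i - r ω i) (i j : Fin n) :
    errCov μ x w i j = ∫ ω, r ω i * r ω j ∂μ := by
  rw [errCov, Matrix.of_apply]
  refine integral_congr_ae ?_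
  filter_upwards [h i, h j] with ω h1 h2
  rw [h1, h2]
  ring

lemma condExp_eq_zero_of_indepFun [IsProbabilityMeasure μ] {f : Ω → ℝ} {w : Ω → β}
    (hf : Measurable f) (hw : Measurable w) (hind : IndepFun f w μ) (h0 : ∫ ω, f ω ∂μ = 0) :
    μ[f | MeasurableSpace.comap w inferInstance] =ᵐ[μ] 0 := by
  have := condExp_indep_eq hf.comap_le hw.comap_le
    (comap_measurable f).stronglyMeasurable ((IndepFun_iff_Indep _ _ _).1 hind)
  rw [h0] at this
  exact this

/-- If `x = r + g w` and the error `r` has conditional mean zero given `w`, then `g w` is the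
conditional mean of `x`. -/
lemma condExp_eq_sub [IsProbabilityMeasure μ] {x r : Ω → ℝ} {w : Ω → β} {g : β → ℝ}
    (hw : Measurable w) (hg : Measurable g) (hx : ∀ ω, x ω = r ω + g (w ω)) (hr : Integrable r μ) (hgw : Integrable (fun ω => g (w ω)) μ)
    (h0 : μ[r | MeasurableSpace.comap w inferInstance] =ᵐ[μ] 0) :
    μ[x | MeasurableSpace.comap w inferInstance] =ᵐ[μ] fun ω => x ω - r ω := by
  have h1 := condExp_add hr hgw (MeasurableSpace.comap w inferInstance)
  have h2 : μ[fun ω => g (w ω) | MeasurableSpace.comap w inferInstance] = fun ω => g (w ω) :=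
    condExp_of_stronglyMeasurable hw.comap_le
      (hg.comp (comap_measurable w)).stronglyMeasurable hgw
  have h3 : x = r + fun ω => g (w ω) := by ext ω; exact hx ω
  rw [h3]
  filter_upwards [h1, h0] with ω h4 h5
  rw [h4, Pi.add_apply, h5, h2]
  simp

lemma integral_sub_condExp_mul {Ω : Type*} {m m0 : MeasurableSpace Ω} {μ : Measure Ω}
    [IsProbabilityMeasure μ] (hm : m ≤ m0) {f g : Ω → ℝ} (hf : MemLp f 2 μ) (hg : MemLp g 2 μ) (hgm : StronglyMeasurable[m] g) :
    ∫ ω, (f ω - (μ[f | m]) ω) * g ω ∂μ = 0 := by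
  have hfg : Integrable (f * g) μ := hf.integrable_mul hg
  have hcg : Integrable (μ[f | m] * g) μ := (hf.condExp one_le_two).integrable_mul hg
  have h1 : ∫ ω, (μ[f * g | m]) ω ∂μ = ∫ ω, (f * g) ω ∂μ := integral_condExp hm
  rw [integral_congr_ae (condExp_mul_of_stronglyMeasurable_right hgm hfg
    (hf.integrable one_le_two))] at h1
  have h2 : ∀ ω, (f ω - (μ[f | m]) ω) * g ω = (f * g) ω - (μ[f | m] * g) ω := fun ω => by
    simp only [Pi.mul_apply]; ring
  simp_rw [h2]
  rw [integral_sub hfg hcg, h1, sub_self]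

lemma memLp_mulVec {a : Ω → Fin n → ℝ} (ha : ∀ i, MemLp (fun ω => a ω i) 2 μ)
    (U : Matrix (Fin n) (Fin n) ℝ) (i : Fin n) : MemLp (fun ω => (U *ᵥ a ω) i) 2 μ := by
  simp only [Matrix.mulVec, dotProduct]
  exact memLp_finsetSum _ fun k _ => (ha k).const_mul _

lemma integral_mulVec_mul_mulVec {a b : Ω → Fin n → ℝ} (ha : ∀ i, MemLp (fun ω => a ω i) 2 μ)
    (hb : ∀ i, MemLp (fun ω => b ω i) 2 μ) (U V : Matrix (Fin n) (Fin n) ℝ) (i j : Fin n) :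
    ∫ ω, (U *ᵥ a ω) i * (V *ᵥ b ω) j ∂μ =
      (U * Matrix.of (fun k l => ∫ ω, a ω k * b ω l ∂μ) * Vᵀ) i j := by
  have h1 : ∀ ω, (U *ᵥ a ω) i * (V *ᵥ b ω) j =
      ∑ l, ∑ k, U i k * V j l * (a ω k * b ω l) := fun ω => by
    simp only [Matrix.mulVec, dotProduct]
    rw [Finset.sum_mul_sum, Finset.sum_comm]
    exact Finset.sum_congr rfl fun _ _ => Finset.sum_congr rfl fun _ _ => by ring
  have hint : ∀ k l, Integrable (fun ω => U i k * V j l * (a ω k * b ω l)) μ := fun k l =>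
    ((ha k).integrable_mul (hb l)).const_mul _
  simp_rw [h1]
  rw [integral_finsetSum _ fun l _ => integrable_finsetSum _ fun k _ => hint k l]
  simp only [Matrix.mul_apply, Matrix.transpose_apply, Matrix.of_apply]
  refine Finset.sum_congr rfl fun l _ => ?_
  rw [integral_finsetSum _ fun k _ => hint k l, Finset.sum_mul]
  refine Finset.sum_congr rfl fun k _ => ?_
  rw [integral_const_mul]
  ring

end SecondMoments


/-! ### Decomposition of the source into independent innovations -/

section Innovations

lemma integral_mul_eq_zero_of_indepFun {Ω : Type*} [MeasurableSpace Ω] {μ : Measure Ω}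
    {f g : Ω → ℝ} (hf : AEStronglyMeasurable f μ) (hg : AEStronglyMeasurable g μ)
    (hind : IndepFun f g μ) (h0 : ∫ ω, f ω ∂μ = 0) : ∫ ω, f ω * g ω ∂μ = 0 := by
  rw [hind.integral_fun_mul_eq_mul_integral hf hg, h0, zero_mul]

lemma errCov_eq_of_condExp_eq_zero {Ω β : Type*} [MeasurableSpace Ω] [MeasurableSpace β]
    {μ : Measure Ω} [IsProbabilityMeasure μ] {n : ℕ} {x r : Ω → EuclideanSpace ℝ (Fin n)}
    {w : Ω → β} {g : β → EuclideanSpace ℝ (Fin n)} (hw : Measurable w) (hg : Measurable g)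
    (hx : ∀ ω, x ω = r ω + g (w ω)) (hr : ∀ i, Integrable (fun ω => r ω i) μ)
    (hgw : ∀ i, Integrable (fun ω => g (w ω) i) μ)
    (h0 : ∀ i, μ[fun ω => r ω i | MeasurableSpace.comap w inferInstance] =ᵐ[μ] 0)
    (i j : Fin n) : errCov μ x w i j = ∫ ω, r ω i * r ω j ∂μ :=
  errCov_eq_integral (fun i => condExp_eq_sub hw (g := fun b => g b i) (by fun_prop)
    (fun ω => by rw [hx]; rfl) (hr i) (hgw i) (h0 i)) i j

variable {nx ny nz : ℕ}

/-- The decomposition `x = e + w + G z` of the source, where `w = innov (y, z)` is the part of the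
estimate of `x` from `(y, z)` that is new with respect to `z`: the error `e` is independent of
`(y, z)`, and the innovation `w` is independent of `z`. -/
structure Innovations (P : Measure (Triple nx ny nz)) where
  innov : EuclideanSpace ℝ (Fin ny) × EuclideanSpace ℝ (Fin nz) →L[ℝ] EuclideanSpace ℝ (Fin nx)
  pred : EuclideanSpace ℝ (Fin nz) →L[ℝ] EuclideanSpace ℝ (Fin nx)
  indep_err : IndepFun (fun t : Triple nx ny nz => t.1 - innov t.2 - pred t.2.2) (fun t => t.2) P
  indep_innov : IndepFun (fun t : Triple nx ny nz => innov t.2) (fun t => t.2.2) P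

variable {P : Measure (Triple nx ny nz)}

lemma nonempty_innovations [IsGaussian P] (hmean : ∫ t, t ∂P = 0) : Nonempty (Innovations P) := by
  have hid : HasGaussianLaw (fun t : Triple nx ny nz => t) P := IsGaussian.hasGaussianLaw_id
  have h0 : ∀ {F : Type} [NormedAddCommGroup F] [NormedSpace ℝ F] [CompleteSpace F]
      (L : Triple nx ny nz →L[ℝ] F), ∫ t, L t ∂P = 0 := fun L => by
    rw [L.integral_comp_comm IsGaussian.integrable_fun_id, hmean, map_zero]
  obtain ⟨L, hL⟩ := exists_regression (P := P) (X := fun t : Triple nx ny nz => t.1)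
    (Y := fun t => t.2) hid (h0 (ContinuousLinearMap.snd ℝ _ _))
  obtain ⟨G, hG⟩ := exists_regression (P := P) (X := fun t : Triple nx ny nz => L t.2)
    (Y := fun t => t.2.2)
    (hid.map ((L ∘L ContinuousLinearMap.snd ℝ _ _).prod
      (ContinuousLinearMap.snd ℝ _ _ ∘L ContinuousLinearMap.snd ℝ _ _)))
    (h0 (ContinuousLinearMap.snd ℝ _ _ ∘L ContinuousLinearMap.snd ℝ _ _))
  refine ⟨⟨L - G ∘L ContinuousLinearMap.snd ℝ _ _, G, ?_, hG⟩⟩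
  convert hL using 2 with t
  simp [sub_sub]

namespace Innovations

variable (D : Innovations P)

/-- The error `e = x - w - G z` of the optimal estimate of `x` from `(y, z)`. -/
noncomputable def err : Triple nx ny nz →L[ℝ] EuclideanSpace ℝ (Fin nx) :=
  ContinuousLinearMap.fst ℝ _ _ - D.innov ∘L ContinuousLinearMap.snd ℝ _ _ -
    D.pred ∘L ContinuousLinearMap.snd ℝ _ _ ∘L ContinuousLinearMap.snd ℝ _ _

/-- The innovation as a function of the whole triple. -/
noncomputable def innovT : Triple nx ny nz →L[ℝ] EuclideanSpace ℝ (Fin nx) :=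
  D.innov ∘L ContinuousLinearMap.snd ℝ _ _

lemma err_apply (t : Triple nx ny nz) : D.err t = t.1 - D.innov t.2 - D.pred t.2.2 := rfl

lemma innovT_apply (t : Triple nx ny nz) : D.innovT t = D.innov t.2 := rfl

lemma eq_err_add (t : Triple nx ny nz) : t.1 = D.err t + D.innovT t + D.pred t.2.2 := by
  rw [err_apply, innovT_apply]; abel

lemma indepFun_err {β : Type*} [MeasurableSpace β]
    {ψ : EuclideanSpace ℝ (Fin ny) × EuclideanSpace ℝ (Fin nz) → β} (hψ : Measurable ψ)
    (i : Fin nx) : IndepFun (fun t => D.err t i) (fun t => ψ t.2) P :=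
  D.indep_err.comp (φ := fun v : EuclideanSpace ℝ (Fin nx) => v i) (by fun_prop) hψ

lemma indepFun_innovT (i : Fin nx) : IndepFun (fun t => D.innovT t i) (fun t => t.2.2) P :=
  D.indep_innov.comp (φ := fun v : EuclideanSpace ℝ (Fin nx) => v i) (ψ := id) (by fun_prop)
    measurable_id

/-- The innovation in the coordinates given by the rows of `U`. -/
noncomputable def rotInnov (U : Matrix (Fin nx) (Fin nx) ℝ)
    (s : EuclideanSpace ℝ (Fin ny) × EuclideanSpace ℝ (Fin nz)) : Fin nx → ℝ :=
  U *ᵥ (D.innov s).ofLp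

@[fun_prop]
lemma continuous_rotInnov (U : Matrix (Fin nx) (Fin nx) ℝ) : Continuous (D.rotInnov U) := by
  unfold rotInnov
  exact Continuous.matrix_mulVec continuous_const (by fun_prop)

end Innovations

section Moments

variable [IsGaussian P]

lemma memLp_apply (L : Triple nx ny nz →L[ℝ] EuclideanSpace ℝ (Fin nx)) (i : Fin nx) :
    MemLp (fun t => L t i) 2 P :=
  ((EuclideanSpace.proj i : EuclideanSpace ℝ (Fin nx) →L[ℝ] ℝ) ∘L L).comp_memLp'
    IsGaussian.memLp_two_fun_id

lemma integral_apply_eq_zero (hmean : ∫ t, t ∂P = 0)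
    (L : Triple nx ny nz →L[ℝ] EuclideanSpace ℝ (Fin nx)) (i : Fin nx) :
    ∫ t, L t i ∂P = 0 := by
  have := ((EuclideanSpace.proj i : EuclideanSpace ℝ (Fin nx) →L[ℝ] ℝ) ∘L L).integral_comp_comm
    (IsGaussian.integrable_fun_id (μ := P))
  rw [hmean, map_zero] at this
  exact this

variable (D : Innovations P)

lemma covXGivenYZ_eq (hmean : ∫ t, t ∂P = 0) (i j : Fin nx) :
    covXGivenYZ P i j = ∫ t, D.err t i * D.err t j ∂P := by
  refine errCov_eq_of_condExp_eq_zero (r := D.err) (by fun_prop)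
    (g := fun s => D.innov s + D.pred s.2) (by fun_prop) (fun t => ?_)
    (fun i => (memLp_apply D.err i).integrable one_le_two)
    (fun i => (memLp_apply (D.innovT + D.pred ∘L ContinuousLinearMap.snd ℝ _ _ ∘L
      ContinuousLinearMap.snd ℝ _ _) i).integrable one_le_two) (fun i => ?_) i j
  · rw [← add_assoc]; exact D.eq_err_add t
  · exact condExp_eq_zero_of_indepFun (by fun_prop) (by fun_prop)
      (D.indepFun_err measurable_id i)
      (integral_apply_eq_zero hmean _ _)

lemma integral_err_mul_innovT (hmean : ∫ t, t ∂P = 0) (i j : Fin nx) :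
    ∫ t, D.err t i * D.innovT t j ∂P = 0 :=
  integral_mul_eq_zero_of_indepFun (memLp_apply _ i).1 (memLp_apply _ j).1
    (D.indepFun_err (ψ := fun s => D.innov s j) (by fun_prop) i)
    (integral_apply_eq_zero hmean _ _)

lemma covXGivenZ_eq (hmean : ∫ t, t ∂P = 0) (i j : Fin nx) :
    covXGivenZ P i j = ∫ t, (D.err + D.innovT) t i * (D.err + D.innovT) t j ∂P := by
  refine errCov_eq_of_condExp_eq_zero (r := (D.err + D.innovT)) (by fun_prop)
    (g := fun s => D.pred s) (by fun_prop) (fun t => D.eq_err_add t)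
    (fun i => (memLp_apply _ i).integrable one_le_two)
    (fun i => (memLp_apply (D.pred ∘L ContinuousLinearMap.snd ℝ _ _ ∘L
      ContinuousLinearMap.snd ℝ _ _) i).integrable one_le_two) (fun i => ?_) i j
  have h1 := condExp_eq_zero_of_indepFun (μ := P) (f := fun t => D.err t i)
    (w := fun t : Triple nx ny nz => t.2.2) (by fun_prop) (by fun_prop)
    (D.indepFun_err measurable_snd i)
    (integral_apply_eq_zero hmean _ _)
  have h2 := condExp_eq_zero_of_indepFun (μ := P) (f := fun t => D.innovT t i)
    (w := fun t : Triple nx ny nz => t.2.2) (by fun_prop) (by fun_prop)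
    (D.indepFun_innovT i)
    (integral_apply_eq_zero hmean _ _)
  have h3 := condExp_add ((memLp_apply (P := P) D.err i).integrable one_le_two)
    ((memLp_apply (P := P) D.innovT i).integrable one_le_two)
    (MeasurableSpace.comap (fun t : Triple nx ny nz => t.2.2) inferInstance)
  refine Filter.EventuallyEq.trans h3 ?_
  filter_upwards [h1, h2] with t h4 h5
  rw [Pi.add_apply, h4, h5, Pi.zero_apply, add_zero]

/-- The covariance matrix of the innovation is `Σ_{x|z} - Σ_{x|yz}`. -/
lemma integral_innovT_mul_innovT (hmean : ∫ t, t ∂P = 0) (i j : Fin nx) :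
    ∫ t, D.innovT t i * D.innovT t j ∂P = (covXGivenZ P - covXGivenYZ P) i j := by
  rw [Matrix.sub_apply, covXGivenZ_eq D hmean, covXGivenYZ_eq D hmean]
  have hm := fun L L' : Triple nx ny nz →L[ℝ] EuclideanSpace ℝ (Fin nx) =>
    (memLp_apply (P := P) L i).integrable_mul (memLp_apply (P := P) L' j)
  have h1 : ∀ t, (D.err + D.innovT) t i * (D.err + D.innovT) t j =
      D.err t i * D.err t j + D.err t i * D.innovT t j +
      (D.innovT t i * D.err t j + D.innovT t i * D.innovT t j) := fun t => by
    simp only [add_apply, PiLp.add_apply]; ring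
  simp_rw [h1]
  rw [integral_add, integral_add, integral_add, integral_err_mul_innovT D hmean]
  · have h2 := integral_err_mul_innovT D hmean j i
    simp_rw [mul_comm (D.err _ j)] at h2
    rw [h2]; ring
  exacts [hm _ _, hm _ _, hm _ _, hm _ _, (hm _ _).add (hm _ _), (hm _ _).add (hm _ _)]

lemma memLp_rotInnov (U : Matrix (Fin nx) (Fin nx) ℝ) (i : Fin nx) :
    MemLp (fun t : Triple nx ny nz => D.rotInnov U t.2 i) 2 P :=
  memLp_mulVec (a := fun t => (D.innovT t).ofLp) (memLp_apply D.innovT) U i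

lemma hasGaussianLaw_rotInnov (U : Matrix (Fin nx) (Fin nx) ℝ) :
    HasGaussianLaw (fun t : Triple nx ny nz => D.rotInnov U t.2) P :=
  (IsGaussian.hasGaussianLaw_id (μ := P)).map_fun
    ((Matrix.mulVecLin U).toContinuousLinearMap ∘L
      (EuclideanSpace.equiv (Fin nx) ℝ).toContinuousLinearMap ∘L D.innovT)

lemma integral_rotInnov (hmean : ∫ t, t ∂P = 0) (U : Matrix (Fin nx) (Fin nx) ℝ) (i : Fin nx) :
    ∫ t : Triple nx ny nz, D.rotInnov U t.2 i ∂P = 0 := by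
  exact integral_apply_eq_zero hmean
    ((EuclideanSpace.equiv (Fin nx) ℝ).symm.toContinuousLinearMap ∘L
      (Matrix.mulVecLin U).toContinuousLinearMap ∘L
      (EuclideanSpace.equiv (Fin nx) ℝ).toContinuousLinearMap ∘L D.innovT) i

variable {U : Matrix (Fin nx) (Fin nx) ℝ} {l : Fin nx → ℝ}

lemma integral_rotInnov_mul (hmean : ∫ t, t ∂P = 0)
    (hU : IsEigenDecomp (covXGivenZ P - covXGivenYZ P) U l) (i j : Fin nx) :
    ∫ t : Triple nx ny nz, D.rotInnov U t.2 i * D.rotInnov U t.2 j ∂P =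
      Matrix.diagonal l i j := by
  have h := integral_mulVec_mul_mulVec (μ := P) (a := fun t => (D.innovT t).ofLp)
    (b := fun t => (D.innovT t).ofLp) (memLp_apply D.innovT) (memLp_apply D.innovT) U U i j
  have h2 : (Matrix.of fun k l => ∫ t, D.innovT t k * D.innovT t l ∂P) =
      covXGivenZ P - covXGivenYZ P := by
    ext k l
    exact integral_innovT_mul_innovT D hmean k l
  have h3 : U * Uᵀ = 1 := by
    have := (Matrix.mem_orthogonalGroup_iff (Fin nx) ℝ).1 hU.1
    simpa [Matrix.star_eq_conjTranspose] using this
  rw [h2] at h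
  refine h.trans (congrFun (congrFun ?_ i) j)
  rw [hU.2]
  calc U * (Uᵀ * Matrix.diagonal l * U) * Uᵀ = (U * Uᵀ) * Matrix.diagonal l * (U * Uᵀ) := by
        simp only [Matrix.mul_assoc]
    _ = Matrix.diagonal l := by rw [h3, one_mul, mul_one]

lemma map_rotInnov (hmean : ∫ t, t ∂P = 0)
    (hU : IsEigenDecomp (covXGivenZ P - covXGivenYZ P) U l) :
    P.map (fun t : Triple nx ny nz => D.rotInnov U t.2) = piGaussian 0 l := by
  refine map_eq_piGaussian (hasGaussianLaw_rotInnov D U) (integral_rotInnov D hmean U)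
    (fun i j hij => ?_) fun i => ?_
  · rw [integral_rotInnov_mul D hmean hU, Matrix.diagonal_apply_ne _ hij]
  · simp_rw [sq]
    rw [integral_rotInnov_mul D hmean hU, Matrix.diagonal_apply_eq]

end Moments

end Innovations


/-! ### The lower bound on the rate -/

section LowerBound

lemma integral_gaussianLLR {Ω ι : Type*} [Fintype ι] [MeasurableSpace Ω] {μ : Measure Ω}
    [IsProbabilityMeasure μ] (v v' : ι → ℝ) {c x : Ω → ι → ℝ}
    (hxc : ∀ i, MemLp (fun ω => x ω i - c ω i) 2 μ) (hx : ∀ i, MemLp (fun ω => x ω i) 2 μ) :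
    Integrable (fun ω => gaussianLLR v v' (c ω) (x ω)) μ ∧
    ∫ ω, gaussianLLR v v' (c ω) (x ω) ∂μ = ∑ i, (1 / 2 * Real.log (v' i / v i) -
      (∫ ω, (x ω i - c ω i) ^ 2 ∂μ) / (2 * v i) + (∫ ω, x ω i ^ 2 ∂μ) / (2 * v' i)) := by
  have h1 : ∀ i, Integrable (fun ω => (x ω i - c ω i) ^ 2 / (2 * v i)) μ := fun i =>
    (hxc i).integrable_sq.div_const _
  have h2 : ∀ i, Integrable (fun ω => x ω i ^ 2 / (2 * v' i)) μ := fun i =>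
    (hx i).integrable_sq.div_const _
  have h3 : ∀ i, Integrable (fun ω => 1 / 2 * Real.log (v' i / v i) -
      (x ω i - c ω i) ^ 2 / (2 * v i)) μ := fun i => (integrable_const _).sub (h1 i)
  have h4 : ∀ i, Integrable (fun ω => 1 / 2 * Real.log (v' i / v i) -
      (x ω i - c ω i) ^ 2 / (2 * v i) + x ω i ^ 2 / (2 * v' i)) μ := fun i => (h3 i).add (h2 i)
  unfold gaussianLLR
  refine ⟨integrable_finsetSum _ fun i _ => h4 i, ?_⟩
  rw [integral_finsetSum _ fun i _ => h4 i]
  refine Finset.sum_congr rfl fun i _ => ?_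
  rw [integral_add (h3 i) (h2 i), integral_sub (integrable_const _) (h1 i), integral_div,
    integral_div]
  simp

/-- The optimality of water-filling: among the error variances `s i ≤ l i` with total at most that
of the water-filling profile `min lam (l i)`, none exceeds the latter on the average weighted by
the inverse of the profile. -/
lemma sum_div_min_le {ι : Type*} [Fintype ι] {l s : ι → ℝ} {lam : ℝ} (hlam : 0 < lam)
    (hl : ∀ i, 0 < l i) (hs : ∀ i, s i ≤ l i) (hsum : ∑ i, s i ≤ ∑ i, min lam (l i)) :
    ∑ i, s i / min lam (l i) ≤ ∑ _i : ι, (1 : ℝ) := by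
  have h1 : ∀ i, s i / min lam (l i) - 1 ≤ (s i - min lam (l i)) / lam := fun i => by
    rcases le_total lam (l i) with h | h
    · rw [min_eq_left h, sub_div, div_self hlam.ne']
    · rw [min_eq_right h]
      have h2 : s i / l i - 1 = (s i - l i) / l i := by rw [sub_div, div_self (hl i).ne']
      rw [h2, div_le_div_iff₀ (hl i) hlam]
      nlinarith [hs i]
  have h3 : ∑ i, (s i / min lam (l i) - 1) ≤ ∑ i, (s i - min lam (l i)) / lam :=
    Finset.sum_le_sum fun i _ => h1 i
  rw [Finset.sum_sub_distrib, ← Finset.sum_div, Finset.sum_sub_distrib] at h3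
  have h4 : (∑ i, s i - ∑ i, min lam (l i)) / lam ≤ 0 :=
    div_nonpos_of_nonpos_of_nonneg (by linarith) hlam.le
  linarith

variable {nx ny nz : ℕ} {P : Measure (Triple nx ny nz)}

lemma Auxiliary.measurePreserving_fst {m : ℕ} (a : Auxiliary P m) :
    MeasurePreserving Prod.fst a.law P := ⟨measurable_fst, a.marginal⟩

lemma Auxiliary.integral_comp_fst {m : ℕ} (a : Auxiliary P m) {f : Triple nx ny nz → ℝ}
    (hf : Measurable f) : ∫ q, f q.1 ∂a.law = ∫ t, f t ∂P := by
  have h := integral_map (μ := a.law) measurable_fst.aemeasurable (f := f)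
    hf.aestronglyMeasurable
  rw [a.marginal] at h
  exact h.symm

lemma Auxiliary.indepFun_comp_fst {α β : Type*} [MeasurableSpace α] [MeasurableSpace β] {m : ℕ}
    (a : Auxiliary P m) {f : Triple nx ny nz → α} {g : Triple nx ny nz → β} (hf : Measurable f)
    (hg : Measurable g) (h : IndepFun f g P) :
    IndepFun (fun q => f q.1) (fun q => g q.1) a.law :=
  (indepFun_map_iff measurable_fst hf hg).1 (by rw [a.marginal]; exact h)

/-- By the Markov property, the auxiliary vector carries no information on the error of the
estimate of `x` from `(y, z)`. -/
lemma Auxiliary.indepFun_err (D : Innovations P) {m : ℕ} (a : Auxiliary P m) :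
    IndepFun (fun q => D.err q.1) (fun q => (q.1.2, q.2)) a.law := by
  refine indepFun_of_condIndepFun (μ := a.law) (k := fun q => q.1.2.1)
    (g := fun q => (q.1.1, q.1.2.2)) (u := fun q => q.2)
    (f := fun c => D.err (c.2.1, (c.1, c.2.2))) (p := fun c => (c.1, c.2.2)) (q := Prod.fst)
    (by fun_prop) (by fun_prop) (by fun_prop) a.markov (by fun_prop) (by fun_prop)
    measurable_fst (fun _ => rfl) ?_
  exact a.indepFun_comp_fst (by fun_prop) (by fun_prop) D.indep_err

variable [IsGaussian P]

lemma Auxiliary.integral_err_mul (hmean : ∫ t, t ∂P = 0) (D : Innovations P) {m : ℕ}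
    (a : Auxiliary P m)
    {ψ : (EuclideanSpace ℝ (Fin ny) × EuclideanSpace ℝ (Fin nz)) × EuclideanSpace ℝ (Fin m) → ℝ}
    (hψ : Measurable ψ) (i : Fin nx) : ∫ q, D.err q.1 i * ψ (q.1.2, q.2) ∂a.law = 0 := by
  refine integral_mul_eq_zero_of_indepFun
    (f := fun q : Triple nx ny nz × EuclideanSpace ℝ (Fin m) => D.err q.1 i)
    (g := fun q => ψ (q.1.2, q.2)) ?_ ?_ ?_ ?_
  · exact (Measurable.aestronglyMeasurable (by fun_prop))
  · exact (Measurable.aestronglyMeasurable (by fun_prop))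
  · exact (a.indepFun_err D).comp (φ := fun v : EuclideanSpace ℝ (Fin nx) => v i) (by fun_prop) hψ
  · exact (a.integral_comp_fst (f := fun t => D.err t i) (by fun_prop)).trans
      (integral_apply_eq_zero hmean _ _)

/-- Every auxiliary vector that meets the mean-squared error constraint has rate at least the
water-filling value. -/
lemma Auxiliary.le_rate (hmean : ∫ t, t ∂P = 0) (D : Innovations P)
    {U : Matrix (Fin nx) (Fin nx) ℝ} {l : Fin nx → ℝ}
    (hU : IsEigenDecomp (covXGivenZ P - covXGivenYZ P) U l) (hl : ∀ i, 0 < l i) {lam : ℝ}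
    (hlam : 0 < lam) {d : ℝ} (hw : IsWaterLevel P d l lam) {m : ℕ} (a : Auxiliary P m)
    (ha : a.errCov.trace ≤ nx * d) :
    ENNReal.ofReal (1 / 2 * ∑ i, Real.log (l i / min lam (l i))) ≤ a.rate := by
  have hUU : Uᵀ * U = 1 := by
    have := (Matrix.mem_orthogonalGroup_iff' (Fin nx) ℝ).1 hU.1
    simpa [Matrix.star_eq_conjTranspose] using this
  set ρ := a.law with hρ
  have hfst := a.measurePreserving_fst
  let w : Triple nx ny nz × EuclideanSpace ℝ (Fin m) →
    EuclideanSpace ℝ (Fin m) × EuclideanSpace ℝ (Fin nz) := fun q => (q.2, q.1.2.2)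
  have hwm : Measurable w := by fun_prop
  let c : Fin nx → Triple nx ny nz × EuclideanSpace ℝ (Fin m) → ℝ := fun i =>
    ρ[fun q => q.1.1 i | MeasurableSpace.comap w inferInstance]
  have hc : ∀ i, ∃ f : EuclideanSpace ℝ (Fin m) × EuclideanSpace ℝ (Fin nz) → ℝ,
      StronglyMeasurable f ∧ c i = f ∘ w := fun i =>
    stronglyMeasurable_condExp.exists_eq_measurable_comp
  choose c' hc'm hc' using hc
  -- the estimate of the innovation from `(z, u)`
  let h : EuclideanSpace ℝ (Fin nz) × EuclideanSpace ℝ (Fin m) → Fin nx → ℝ :=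
    fun s i => c' i (s.2, s.1) - D.pred s.1 i
  have hhi : ∀ i, Measurable fun s => h s i := fun i => by
    have := (hc'm i).measurable
    fun_prop
  have hh : Measurable h := measurable_pi_lambda _ hhi
  let H : Triple nx ny nz × EuclideanSpace ℝ (Fin m) → Fin nx → ℝ := fun q => h (q.1.2.2, q.2)
  let Δ : Triple nx ny nz × EuclideanSpace ℝ (Fin m) → Fin nx → ℝ :=
    fun q i => D.innovT q.1 i - H q i
  have hcq : ∀ i q, c i q = c' i (q.2, q.1.2.2) := fun i q => by rw [hc' i]; rfl
  have hres : ∀ i q, q.1.1 i - c i q = D.err q.1 i + Δ q i := fun i q => by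
    rw [hcq, D.eq_err_add q.1]
    simp only [Δ, H, h, PiLp.add_apply]
    ring
  have hL : ∀ (L : Triple nx ny nz →L[ℝ] EuclideanSpace ℝ (Fin nx)) (i : Fin nx),
      MemLp (fun q : Triple nx ny nz × EuclideanSpace ℝ (Fin m) => L q.1 i) 2 ρ := fun L i =>
    (memLp_apply (P := P) L i).comp_measurePreserving hfst
  have hx2 : ∀ i, MemLp (fun q : Triple nx ny nz × EuclideanSpace ℝ (Fin m) => q.1.1 i) 2 ρ :=
    hL (ContinuousLinearMap.fst ℝ _ _)
  have hc2 : ∀ i, MemLp (c i) 2 ρ := fun i => (hx2 i).condExp one_le_two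
  have hH2 : ∀ i, MemLp (fun q => H q i) 2 ρ := fun i => by
    refine ((hc2 i).sub (hL (D.pred ∘L ContinuousLinearMap.snd ℝ _ _ ∘L
      ContinuousLinearMap.snd ℝ _ _) i)).congr_norm ((hhi i).comp (by fun_prop)).aestronglyMeasurable
      (Filter.Eventually.of_forall fun q => ?_)
    simp only [Pi.sub_apply, hcq]
    rfl
  have hΔ2 : ∀ i, MemLp (fun q => Δ q i) 2 ρ := fun i => (hL D.innovT i).sub (hH2 i)
  have hΔm : ∀ i, ∃ ψ : (EuclideanSpace ℝ (Fin ny) × EuclideanSpace ℝ (Fin nz)) ×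
      EuclideanSpace ℝ (Fin m) → ℝ, Measurable ψ ∧ ∀ q, Δ q i = ψ (q.1.2, q.2) := fun i =>
    ⟨fun s => D.innov s.1 i - h (s.1.2, s.2) i,
      (by fun_prop : Measurable fun s : (EuclideanSpace ℝ (Fin ny) ×
        EuclideanSpace ℝ (Fin nz)) × EuclideanSpace ℝ (Fin m) => D.innov s.1 i).sub
          ((hhi i).comp (by fun_prop)), fun q => rfl⟩
  have herrΔ : ∀ i j, ∫ q, D.err q.1 i * Δ q j ∂ρ = 0 := fun i j => by
    obtain ⟨ψ, hψ, hψΔ⟩ := hΔm j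
    simp_rw [hψΔ]
    exact a.integral_err_mul hmean D hψ i
  have herrH : ∀ i j, ∫ q, D.err q.1 i * H q j ∂ρ = 0 := fun i j =>
    a.integral_err_mul hmean D (ψ := fun s => h (s.1.2, s.2) j) ((hhi j).comp (by fun_prop)) i
  -- the diagonal of the error covariance splits
  have htrace : a.errCov.trace = (covXGivenYZ P).trace + ∑ i, ∫ q, Δ q i * Δ q i ∂ρ := by
    rw [Matrix.trace, Matrix.trace, ← Finset.sum_add_distrib]
    refine Finset.sum_congr rfl fun i _ => ?_
    rw [Matrix.diag_apply, Matrix.diag_apply, covXGivenYZ_eq D hmean,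
      ← a.integral_comp_fst (f := fun t => D.err t i * D.err t i) (by fun_prop)]
    have h1 : a.errCov i i = ∫ q, (D.err q.1 i + Δ q i) * (D.err q.1 i + Δ q i) ∂ρ := by
      rw [Auxiliary.errCov, RemoteWynerZiv.errCov, Matrix.of_apply]
      refine integral_congr_ae (Filter.Eventually.of_forall fun q => ?_)
      show (q.1.1 i - c i q) * (q.1.1 i - c i q) = _
      rw [hres]
    have h2 : ∀ q, (D.err q.1 i + Δ q i) * (D.err q.1 i + Δ q i) =
        D.err q.1 i * D.err q.1 i + 2 * (D.err q.1 i * Δ q i) + Δ q i * Δ q i := fun q => by ring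
    have i1 : Integrable (fun q => D.err q.1 i * D.err q.1 i) ρ :=
      (hL D.err i).integrable_mul (hL D.err i)
    have i2 : Integrable (fun q => 2 * (D.err q.1 i * Δ q i)) ρ :=
      ((hL D.err i).integrable_mul (hΔ2 i)).const_mul 2
    have i3 : Integrable (fun q => Δ q i * Δ q i) ρ := (hΔ2 i).integrable_mul (hΔ2 i)
    have i12 : Integrable (fun q => D.err q.1 i * D.err q.1 i + 2 * (D.err q.1 i * Δ q i)) ρ :=
      i1.add i2
    rw [h1]
    simp_rw [h2]
    rw [integral_add i12 i3, integral_add i1 i2, integral_const_mul, herrΔ, mul_zero,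
      add_zero]
  -- the error of the estimate is orthogonal to the estimate
  have horth : ∀ k j, ∫ q, Δ q k * H q j ∂ρ = 0 := fun k j => by
    have h1 : ∫ q, (q.1.1 k - c k q) * H q j ∂ρ = 0 := by
      refine integral_sub_condExp_mul (m := MeasurableSpace.comap w inferInstance)
        hwm.comap_le (hx2 k) (hH2 j) ?_
      exact (((hhi j).comp (by fun_prop : Measurable fun s : EuclideanSpace ℝ (Fin m) ×
        EuclideanSpace ℝ (Fin nz) => (s.2, s.1))).comp (comap_measurable w)).stronglyMeasurable
    simp_rw [hres, add_mul] at h1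
    have i1 : Integrable (fun q => D.err q.1 k * H q j) ρ := (hL D.err k).integrable_mul (hH2 j)
    have i2 : Integrable (fun q => Δ q k * H q j) ρ := (hΔ2 k).integrable_mul (hH2 j)
    rw [integral_add i1 i2,
      herrH, zero_add] at h1
    exact h1
  let W : Triple nx ny nz × EuclideanSpace ℝ (Fin m) → Fin nx → ℝ := fun q => D.rotInnov U q.1.2
  have hWdec : ∀ q, W q = U *ᵥ Δ q + U *ᵥ H q := fun q => by
    rw [← Matrix.mulVec_add]
    show U *ᵥ (D.innov q.1.2).ofLp = _
    congr 1
    ext i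
    simp [Δ, Innovations.innovT_apply]
  have hW2 : ∀ i, MemLp (fun q => W q i) 2 ρ := fun i =>
    (memLp_rotInnov D U i).comp_measurePreserving hfst
  have hUΔ2 := memLp_mulVec hΔ2 U
  have hUH2 := memLp_mulVec hH2 U
  have hsub : ∀ q i, W q i - (U *ᵥ H q) i = (U *ᵥ Δ q) i := fun q i => by
    rw [hWdec, Pi.add_apply]; ring
  let s : Fin nx → ℝ := fun i => ∫ q, (U *ᵥ Δ q) i ^ 2 ∂ρ
  have hWvar : ∀ i, ∫ q, W q i ^ 2 ∂ρ = l i := fun i => by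
    have h1 := integral_rotInnov_mul D hmean hU i i
    rw [Matrix.diagonal_apply_eq] at h1
    rw [← h1, ← a.integral_comp_fst (f := fun t => D.rotInnov U t.2 i * D.rotInnov U t.2 i)
      (by fun_prop)]
    simp_rw [sq]
    rfl
  have hs : ∀ i, s i ≤ l i := fun i => by
    have h0 : ∫ q, (U *ᵥ Δ q) i * (U *ᵥ H q) i ∂ρ = 0 := by
      rw [integral_mulVec_mul_mulVec hΔ2 hH2]
      simp_rw [horth]
      rw [show (Matrix.of fun _ _ => (0 : ℝ) : Matrix (Fin nx) (Fin nx) ℝ) = 0 from rfl]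
      simp
    have h1 : ∀ q, W q i ^ 2 = (U *ᵥ Δ q) i ^ 2 + 2 * ((U *ᵥ Δ q) i * (U *ᵥ H q) i) +
        (U *ᵥ H q) i ^ 2 := fun q => by rw [hWdec, Pi.add_apply]; ring
    have i1 := (hUΔ2 i).integrable_sq
    have i2 : Integrable (fun q => 2 * ((U *ᵥ Δ q) i * (U *ᵥ H q) i)) ρ :=
      ((hUΔ2 i).integrable_mul (hUH2 i)).const_mul 2
    have i3 := (hUH2 i).integrable_sq
    have i12 : Integrable (fun q => (U *ᵥ Δ q) i ^ 2 +
      2 * ((U *ᵥ Δ q) i * (U *ᵥ H q) i)) ρ := i1.add i2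
    rw [← hWvar i]
    simp_rw [h1]
    rw [integral_add i12 i3, integral_add i1 i2, integral_const_mul, h0]
    have : 0 ≤ ∫ q, (U *ᵥ H q) i ^ 2 ∂ρ := integral_nonneg fun q => sq_nonneg _
    linarith
  have hsum : ∑ i, s i ≤ ∑ i, min lam (l i) := by
    have h1 : ∑ i, s i = ∑ i, ∫ q, Δ q i * Δ q i ∂ρ := by
      have h2 : ∀ i, s i = (U * (Matrix.of fun k j => ∫ q, Δ q k * Δ q j ∂ρ) * Uᵀ) i i := fun i => by
        rw [← integral_mulVec_mul_mulVec hΔ2 hΔ2]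
        simp_rw [← sq]
        rfl
      calc ∑ i, s i = (U * (Matrix.of fun k j => ∫ q, Δ q k * Δ q j ∂ρ) * Uᵀ).trace :=
            Finset.sum_congr rfl fun i _ => h2 i
        _ = (Matrix.of fun k j => ∫ q, Δ q k * Δ q j ∂ρ).trace := by
            rw [Matrix.trace_mul_comm, ← Matrix.mul_assoc, hUU, one_mul]
        _ = _ := rfl
    rw [h1, hw]
    linarith
  -- the divergence bound
  have hUh : Measurable fun s => U *ᵥ h s :=
    (Continuous.matrix_mulVec continuous_const continuous_id : Continuous fun v : Fin nx → ℝ =>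
      U *ᵥ v).measurable.comp hh
  obtain ⟨hint, hval⟩ := integral_gaussianLLR (μ := ρ) (fun i => min lam (l i)) l
    (c := fun q => U *ᵥ H q) (x := W) (fun i => by simp_rw [hsub]; exact hUΔ2 i) hW2
  have hφ : Measurable fun p : EuclideanSpace ℝ (Fin nz) × EuclideanSpace ℝ (Fin ny) =>
      D.rotInnov U (p.2, p.1) := by fun_prop
  have hindW : IndepFun (fun q : Triple nx ny nz × EuclideanSpace ℝ (Fin m) => q.1.2.2)
      (fun q => D.rotInnov U (q.1.2.1, q.1.2.2)) ρ := by
    have h1 : IndepFun (fun t : Triple nx ny nz => t.2.2) (fun t => D.rotInnov U t.2) P :=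
      (D.indep_innov.comp (φ := fun v : EuclideanSpace ℝ (Fin nx) => U *ᵥ v.ofLp) (ψ := id)
        (Continuous.matrix_mulVec continuous_const (by fun_prop)).measurable measurable_id).symm
    exact a.indepFun_comp_fst (by fun_prop) (by fun_prop) h1
  have hWlaw : ρ.map (fun q => D.rotInnov U (q.1.2.1, q.1.2.2)) = piGaussian 0 l := by
    have hmW : Measurable fun t : Triple nx ny nz => D.rotInnov U t.2 := by fun_prop
    have h1 := Measure.map_map (μ := a.law) hmW measurable_fst
    rw [a.marginal, map_rotInnov D hmean hU] at h1
    exact h1.symm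
  have hkl := klDiv_le_condMutualInfo (μ := ρ) (y := fun q => q.2) (u := fun q => q.1.2.1)
    (z := fun q => q.1.2.2) (by fun_prop) (by fun_prop) (by fun_prop) hφ hindW
  rw [hWlaw] at hkl
  have hm1 : Measurable fun q : Triple nx ny nz × EuclideanSpace ℝ (Fin m) =>
      ((q.1.2.2, q.2), D.rotInnov U (q.1.2.1, q.1.2.2)) := by fun_prop
  have hm2 : Measurable fun q : Triple nx ny nz × EuclideanSpace ℝ (Fin m) =>
      (q.1.2.2, q.2) := by fun_prop
  have := Measure.isProbabilityMeasure_map (μ := ρ) hm1.aemeasurable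
  have := Measure.isProbabilityMeasure_map (μ := ρ) hm2.aemeasurable
  have hv : ∀ i, 0 < min lam (l i) := fun i => lt_min hlam (hl i)
  have hLm : Measurable fun p : (EuclideanSpace ℝ (Fin nz) × EuclideanSpace ℝ (Fin m)) ×
      (Fin nx → ℝ) => gaussianLLR (fun i => min lam (l i)) l (U *ᵥ h p.1) p.2 :=
    measurable_gaussianLLR (fun i => min lam (l i)) l (hUh.comp measurable_fst) measurable_snd
  have hDV := le_klDiv_prod_piGaussian (ρ.map fun q => (q.1.2.2, q.2)) hv hl hUh
    (ρ.map fun q => ((q.1.2.2, q.2), D.rotInnov U (q.1.2.1, q.1.2.2)))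
    ((integrable_map_measure hLm.aestronglyMeasurable hm1.aemeasurable).2 hint)
  rw [integral_map hm1.aemeasurable hLm.aestronglyMeasurable] at hDV
  refine le_trans ?_ (hDV.trans (hkl.trans (condMutualInfo_comm_le (by fun_prop) (by fun_prop)
    (by fun_prop))))
  refine ENNReal.ofReal_le_ofReal (le_of_le_of_eq ?_ hval.symm)
  simp_rw [hsub, hWvar]
  have hfin := sum_div_min_le hlam hl hs hsum
  have h1 : ∀ i, 1 / 2 * Real.log (l i / min lam (l i)) - s i / (2 * min lam (l i)) +
      l i / (2 * l i) = 1 / 2 * Real.log (l i / min lam (l i)) +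
        1 / 2 * (1 - s i / min lam (l i)) := fun i => by
    have := (hv i).ne'
    have := (hl i).ne'
    field_simp
    ring
  calc 1 / 2 * ∑ i, Real.log (l i / min lam (l i)) ≤ 1 / 2 * ∑ i, Real.log (l i / min lam (l i)) +
        1 / 2 * (∑ _i : Fin nx, (1 : ℝ) - ∑ i, s i / min lam (l i)) := by linarith
    _ = ∑ i, (1 / 2 * Real.log (l i / min lam (l i)) - s i / (2 * min lam (l i)) +
          l i / (2 * l i)) := by
        simp_rw [h1]
        rw [Finset.sum_add_distrib, Finset.mul_sum, ← Finset.mul_sum (f := fun i =>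
          1 - s i / min lam (l i)), Finset.sum_sub_distrib]

end LowerBound


/-! ### The Gaussian test channel -/

section TestChannel

variable {Ω ι : Type*} [Fintype ι] [MeasurableSpace Ω] {μ : Measure Ω}

lemma map_eval_piGaussian (c v : ι → ℝ) (i : ι) :
    (piGaussian c v).map (fun x => x i) = gaussianReal (c i) (v i).toNNReal :=
  (measurePreserving_eval (fun i => gaussianReal (c i) (v i).toNNReal) i).map_eq

lemma hasGaussianLaw_eval_piGaussian (c v : ι → ℝ) (i : ι) :
    HasGaussianLaw (fun x : ι → ℝ => x i) (piGaussian c v) :=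
  ⟨by rw [map_eval_piGaussian]; infer_instance⟩

lemma iIndepFun_piGaussian (c v : ι → ℝ) :
    iIndepFun (fun i (x : ι → ℝ) => x i) (piGaussian c v) :=
  iIndepFun_pi (μ := fun i => gaussianReal (c i) (v i).toNNReal) (X := fun _ x => x)
    fun _ => aemeasurable_id

instance (c v : ι → ℝ) : IsGaussian (piGaussian c v) := by
  have h := (iIndepFun.hasGaussianLaw (hasGaussianLaw_eval_piGaussian c v)
    (iIndepFun_piGaussian c v)).isGaussian_map
  rwa [show (fun x : ι → ℝ => fun i => x i) = id from rfl, Measure.map_id] at h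

lemma integral_eval_piGaussian (v : ι → ℝ) (i : ι) : ∫ x, x i ∂piGaussian 0 v = 0 := by
  have h := integral_map (μ := piGaussian 0 v) (measurable_pi_apply i).aemeasurable
    (f := fun x : ℝ => x) measurable_id.aestronglyMeasurable
  rw [map_eval_piGaussian, integral_id_gaussianReal] at h
  exact h.symm

lemma integral_eval_mul_eval_piGaussian [DecidableEq ι] {v : ι → ℝ} (hv : ∀ i, 0 ≤ v i) (i j : ι) :
    ∫ x, x i * x j ∂piGaussian 0 v = Matrix.diagonal v i j := by
  by_cases hij : i = j
  · subst hij
    have h1 := variance_eq_sub (hasGaussianLaw_eval_piGaussian 0 v i).memLp_two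
    have h2 := (hasGaussianLaw_eval_piGaussian 0 v i).map_eq_gaussianReal
    rw [map_eval_piGaussian] at h2
    have h3 := variance_fun_id_gaussianReal (μ := 0) (v := (v i).toNNReal)
    have h4 : Var[fun x : ι → ℝ => x i; piGaussian 0 v] = v i := by
      have h5 := variance_map (μ := piGaussian 0 v) (X := fun x : ℝ => x)
        measurable_id.aemeasurable (measurable_pi_apply i).aemeasurable
      rw [map_eval_piGaussian] at h5
      rw [Pi.zero_apply, h3, Real.coe_toNNReal _ (hv i)] at h5
      exact h5.symm
    rw [Matrix.diagonal_apply_eq, ← h4, h1, integral_eval_piGaussian]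
    simp [sq]
  · rw [Matrix.diagonal_apply_ne _ hij]
    exact integral_mul_eq_zero_of_indepFun (measurable_pi_apply i).aestronglyMeasurable
      (measurable_pi_apply j).aestronglyMeasurable ((iIndepFun_piGaussian 0 v).indepFun hij)
      (integral_eval_piGaussian v i)

lemma memLp_of_map_eq_piGaussian {X : Ω → ι → ℝ} {v : ι → ℝ}
    (h : μ.map X = piGaussian 0 v) (i : ι) : MemLp (fun ω => X ω i) 2 μ :=
  (HasGaussianLaw.eval (X := fun i ω => X ω i)
    (⟨by rw [h]; infer_instance⟩ : HasGaussianLaw X μ) i).memLp_two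

lemma integral_sq_of_map_eq_piGaussian {X : Ω → ι → ℝ} (hX : Measurable X) {v : ι → ℝ}
    (hv : ∀ i, 0 ≤ v i) (h : μ.map X = piGaussian 0 v) (i : ι) : ∫ ω, X ω i ^ 2 ∂μ = v i := by
  classical
  have h1 := integral_map (μ := μ) hX.aemeasurable (f := fun x => x i * x i)
    ((measurable_pi_apply i).mul (measurable_pi_apply i)).aestronglyMeasurable
  rw [h, integral_eval_mul_eval_piGaussian hv, Matrix.diagonal_apply_eq] at h1
  simp_rw [sq]
  exact h1.symm

lemma integral_lin_mul_lin {f f' g g' : Ω → ℝ} (hf : MemLp f 2 μ) (hf' : MemLp f' 2 μ)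
    (hg : MemLp g 2 μ) (hg' : MemLp g' 2 μ) (a a' b b' : ℝ) :
    ∫ ω, (a * f ω + a' * f' ω) * (b * g ω + b' * g' ω) ∂μ =
      a * b * ∫ ω, f ω * g ω ∂μ + a * b' * ∫ ω, f ω * g' ω ∂μ +
      (a' * b * ∫ ω, f' ω * g ω ∂μ + a' * b' * ∫ ω, f' ω * g' ω ∂μ) := by
  have h1 : ∀ ω, (a * f ω + a' * f' ω) * (b * g ω + b' * g' ω) =
      a * b * (f ω * g ω) + a * b' * (f ω * g' ω) +
      (a' * b * (f' ω * g ω) + a' * b' * (f' ω * g' ω)) := fun ω => by ring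
  have i1 : Integrable (fun ω => a * b * (f ω * g ω)) μ := (hf.integrable_mul hg).const_mul _
  have i2 : Integrable (fun ω => a * b' * (f ω * g' ω)) μ := (hf.integrable_mul hg').const_mul _
  have i3 : Integrable (fun ω => a' * b * (f' ω * g ω)) μ := (hf'.integrable_mul hg).const_mul _
  have i4 : Integrable (fun ω => a' * b' * (f' ω * g' ω)) μ :=
    (hf'.integrable_mul hg').const_mul _
  have i12 : Integrable (fun ω => a * b * (f ω * g ω) + a * b' * (f ω * g' ω)) μ := i1.add i2
  have i34 : Integrable (fun ω => a' * b * (f' ω * g ω) + a' * b' * (f' ω * g' ω)) μ := i3.add i4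
  simp_rw [h1]
  rw [integral_add i12 i34, integral_add i1 i2, integral_add i3 i4]
  simp_rw [integral_const_mul]

/-- A Gaussian vector `w` with independent coordinates of variance `l i` is observed through
`v = a w + n` with independent standard Gaussian noise `n`. If `a² = 1 / m - 1 / l`, then the error
`w - a m v` of the optimal estimate is independent of `v` and has independent coordinates of variance
`m i`. -/
lemma gaussian_testChannel [DecidableEq ι] [IsProbabilityMeasure μ] {w n : Ω → ι → ℝ}
    {l m a : ι → ℝ} (hl : ∀ i, 0 < l i) (hm : ∀ i, 0 < m i) (ha : ∀ i, a i ^ 2 = 1 / m i - 1 / l i)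
    (hw : HasGaussianLaw w μ) (hw0 : ∀ i, ∫ ω, w ω i ∂μ = 0)
    (hww : ∀ i j, ∫ ω, w ω i * w ω j ∂μ = Matrix.diagonal l i j)
    (hn : Measurable n) (hlaw : μ.map n = piGaussian 0 1) (hind : IndepFun w n μ) :
    μ.map (fun ω i => a i * w ω i + n ω i) = piGaussian 0 (fun i => l i / m i) ∧
    IndepFun (fun ω i => w ω i - a i * m i * (a i * w ω i + n ω i))
      (fun ω i => a i * w ω i + n ω i) μ ∧
    (∀ i, ∫ ω, (w ω i - a i * m i * (a i * w ω i + n ω i)) ∂μ = 0) ∧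
    (∀ i j, ∫ ω, (w ω i - a i * m i * (a i * w ω i + n ω i)) *
      (w ω j - a j * m j * (a j * w ω j + n ω j)) ∂μ = Matrix.diagonal m i j) := by
  have hnG : HasGaussianLaw n μ := ⟨by rw [hlaw]; infer_instance⟩
  have hwn : HasGaussianLaw (fun ω => (w ω, n ω)) μ := hind.hasGaussianLaw hw hnG
  have hw2 : ∀ i, MemLp (fun ω => w ω i) 2 μ := fun i =>
    (hw.eval (X := fun i ω => w ω i) i).memLp_two
  have hn2 : ∀ i, MemLp (fun ω => n ω i) 2 μ := fun i =>
    (hnG.eval (X := fun i ω => n ω i) i).memLp_two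
  have hn0 : ∀ i, ∫ ω, n ω i ∂μ = 0 := fun i => by
    have h := integral_map (μ := μ) hn.aemeasurable (f := fun x => x i)
      (measurable_pi_apply i).aestronglyMeasurable
    rw [hlaw, integral_eval_piGaussian] at h
    exact h.symm
  have hnn : ∀ i j, ∫ ω, n ω i * n ω j ∂μ = Matrix.diagonal 1 i j := fun i j => by
    have h := integral_map (μ := μ) hn.aemeasurable (f := fun x => x i * x j)
      ((measurable_pi_apply i).mul (measurable_pi_apply j)).aestronglyMeasurable
    rw [hlaw, integral_eval_mul_eval_piGaussian (v := 1) fun _ => zero_le_one] at h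
    exact h.symm
  have hwn0 : ∀ i j, ∫ ω, w ω i * n ω j ∂μ = 0 := fun i j =>
    integral_mul_eq_zero_of_indepFun (hw2 i).1 (hn2 j).1
      (hind.comp (measurable_pi_apply i) (measurable_pi_apply j)) (hw0 i)
  have hnw0 : ∀ i j, ∫ ω, n ω i * w ω j ∂μ = 0 := fun i j => by
    simp_rw [mul_comm (n _ i)]; exact hwn0 j i
  have hcov : ∀ i j (α β γ δ : ℝ), ∫ ω, (α * w ω i + β * n ω i) * (γ * w ω j + δ * n ω j) ∂μ =
      α * γ * Matrix.diagonal l i j + β * δ * Matrix.diagonal 1 i j := fun i j α β γ δ => by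
    rw [integral_lin_mul_lin (hw2 i) (hn2 i) (hw2 j) (hn2 j), hww, hnn, hwn0, hnw0]
    ring
  have hmean : ∀ i (α β : ℝ), ∫ ω, (α * w ω i + β * n ω i) ∂μ = 0 := fun i α β => by
    rw [integral_add (((hw2 i).integrable one_le_two).const_mul _)
      (((hn2 i).integrable one_le_two).const_mul _), integral_const_mul, integral_const_mul, hw0,
      hn0]
    ring
  have hmem : ∀ i (α β : ℝ), MemLp (fun ω => α * w ω i + β * n ω i) 2 μ := fun i α β =>
    ((hw2 i).const_mul α).add ((hn2 i).const_mul β)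
  have hv : ∀ ω i, a i * w ω i + n ω i = a i * w ω i + 1 * n ω i := fun ω i => by ring
  have hr : ∀ ω i, w ω i - a i * m i * (a i * w ω i + 1 * n ω i) =
      (1 - a i * m i * a i) * w ω i + (-(a i * m i)) * n ω i := fun ω i => by ring
  have ha1 : ∀ i, a i * a i * l i + 1 = l i / m i := fun i => by
    have h1 := (hl i).ne'
    have h2 := (hm i).ne'
    rw [← sq, ha]
    field_simp
    ring
  have ha2 : ∀ i, m i * (a i * a i * l i + 1) = l i := fun i => by
    rw [ha1, mul_div_cancel₀ _ (hm i).ne']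
  simp_rw [hv, hr]
  -- linear images of `(w, n)` are Gaussian
  let Lw : ι → ((ι → ℝ) × (ι → ℝ)) →L[ℝ] ℝ := fun i =>
    ContinuousLinearMap.proj i ∘L ContinuousLinearMap.fst ℝ _ _
  let Ln : ι → ((ι → ℝ) × (ι → ℝ)) →L[ℝ] ℝ := fun i =>
    ContinuousLinearMap.proj i ∘L ContinuousLinearMap.snd ℝ _ _
  let L : (ι → ℝ) → (ι → ℝ) → ((ι → ℝ) × (ι → ℝ)) →L[ℝ] (ι → ℝ) := fun α β =>
    ContinuousLinearMap.pi fun i => α i • Lw i + β i • Ln i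
  refine ⟨?_, ?_, fun i => hmean i _ _, fun i j => ?_⟩
  · refine map_eq_piGaussian (hwn.map_fun (L a 1)) (fun i => hmean i _ _)
      (fun i j hij => ?_) fun i => ?_
    · rw [hcov, Matrix.diagonal_apply_ne _ hij, Matrix.diagonal_apply_ne _ hij]
      ring
    · simp_rw [sq]
      rw [hcov, Matrix.diagonal_apply_eq, Matrix.diagonal_apply_eq, ← ha1, Pi.one_apply]
      ring
  · refine HasGaussianLaw.indepFun_of_covariance_eval (hwn.map_fun
      ((L (fun i => 1 - a i * m i * a i) (fun i => -(a i * m i))).prod (L a 1))) fun i j => ?_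
    rw [covariance_eq_sub (hmem _ _ _) (hmem _ _ _), hmean, zero_mul, sub_zero]
    refine (hcov _ _ _ _ _ _).trans ?_
    by_cases hij : i = j
    · subst hij
      rw [Matrix.diagonal_apply_eq, Matrix.diagonal_apply_eq, Pi.one_apply]
      linear_combination (-a i) * ha2 i
    · rw [Matrix.diagonal_apply_ne _ hij, Matrix.diagonal_apply_ne _ hij]
      ring
  · rw [hcov]
    by_cases hij : i = j
    · subst hij
      rw [Matrix.diagonal_apply_eq, Matrix.diagonal_apply_eq, Matrix.diagonal_apply_eq,
        Pi.one_apply]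
      have h1 : a i * a i * m i * l i = l i - m i := by linear_combination ha2 i
      linear_combination (-1 + a i * a i * m i) * h1 - a i * a i * m i * ha2 i + a i * a i * m i * h1
    · rw [Matrix.diagonal_apply_ne _ hij, Matrix.diagonal_apply_ne _ hij,
        Matrix.diagonal_apply_ne _ hij]
      ring

end TestChannel


/-! ### The auxiliary vector that attains the minimum -/

section Achievability

variable {nx ny nz : ℕ} {P : Measure (Triple nx ny nz)}

lemma Innovations.rotInnov_add (D : Innovations P) (U : Matrix (Fin nx) (Fin nx) ℝ)
    (y : EuclideanSpace ℝ (Fin ny)) (z : EuclideanSpace ℝ (Fin nz)) (i : Fin nx) :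
    D.rotInnov U (y, z) i = D.rotInnov U (y, 0) i + D.rotInnov U (0, z) i := by
  have h : D.innov (y, z) = D.innov (y, 0) + D.innov (0, z) := by
    rw [← map_add, Prod.mk_add_mk, add_zero, zero_add]
  rw [Innovations.rotInnov, h, WithLp.ofLp_add, Matrix.mulVec_add]
  rfl

/-- The channel from `y` to `u`: the part of the innovation due to `y`, in the coordinates given by
the rows of `U`, is scaled by `a` and observed with additive noise. -/
noncomputable def Innovations.channel (D : Innovations P) (U : Matrix (Fin nx) (Fin nx) ℝ)
    (a : Fin nx → ℝ) (s : EuclideanSpace ℝ (Fin ny) × (Fin nx → ℝ)) :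
    EuclideanSpace ℝ (Fin nx) :=
  WithLp.toLp 2 fun i => a i * D.rotInnov U (s.1, 0) i + s.2 i

@[fun_prop]
lemma Innovations.measurable_channel (D : Innovations P) (U : Matrix (Fin nx) (Fin nx) ℝ)
    (a : Fin nx → ℝ) : Measurable (D.channel U a) := by
  unfold Innovations.channel
  fun_prop

/-- The noise of the channel, recovered from its input and output. -/
noncomputable def Innovations.noise (D : Innovations P) (U : Matrix (Fin nx) (Fin nx) ℝ)
    (a : Fin nx → ℝ) (q : Triple nx ny nz × EuclideanSpace ℝ (Fin nx)) : Fin nx → ℝ :=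
  fun i => q.2 i - a i * D.rotInnov U (q.1.2.1, 0) i

@[fun_prop]
lemma Innovations.measurable_noise (D : Innovations P) (U : Matrix (Fin nx) (Fin nx) ℝ)
    (a : Fin nx → ℝ) : Measurable (D.noise U a) := by
  unfold Innovations.noise
  fun_prop

lemma Innovations.add_noise (D : Innovations P) (U : Matrix (Fin nx) (Fin nx) ℝ)
    (a : Fin nx → ℝ) (q : Triple nx ny nz × EuclideanSpace ℝ (Fin nx)) (i : Fin nx) :
    a i * D.rotInnov U q.1.2 i + D.noise U a q i =
      q.2 i + a i * D.rotInnov U (0, q.1.2.2) i := by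
  rw [show q.1.2 = (q.1.2.1, q.1.2.2) from rfl, D.rotInnov_add U, Innovations.noise]
  ring

/-- The joint law of the triple and of the output of the channel with standard Gaussian noise. -/
noncomputable def Innovations.gaussianLaw (D : Innovations P) (U : Matrix (Fin nx) (Fin nx) ℝ)
    (a : Fin nx → ℝ) : Measure (Triple nx ny nz × EuclideanSpace ℝ (Fin nx)) :=
  (P.prod (piGaussian 0 1)).map fun p => (p.1, D.channel U a (p.1.2.1, p.2))

lemma Innovations.map_gaussianLaw {β : Type*} [MeasurableSpace β] (D : Innovations P)
    (U : Matrix (Fin nx) (Fin nx) ℝ) (a : Fin nx → ℝ)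
    {f : Triple nx ny nz × EuclideanSpace ℝ (Fin nx) → β} (hf : Measurable f) :
    (D.gaussianLaw U a).map f =
      (P.prod (piGaussian 0 1)).map fun p => f (p.1, D.channel U a (p.1.2.1, p.2)) :=
  Measure.map_map hf (by fun_prop)

lemma Innovations.map_fst_gaussianLaw {β : Type*} [MeasurableSpace β] (D : Innovations P)
    (U : Matrix (Fin nx) (Fin nx) ℝ) (a : Fin nx → ℝ) {f : Triple nx ny nz → β}
    (hf : Measurable f) : (D.gaussianLaw U a).map (fun q => f q.1) = P.map f := by
  have h := Measure.map_map (μ := P.prod (piGaussian (0 : Fin nx → ℝ) 1)) hf measurable_fst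
  rw [Measure.map_fst_prod, measure_univ, one_smul] at h
  rw [D.map_gaussianLaw U a (f := fun q => f q.1) (hf.comp measurable_fst), h]
  rfl

variable [IsProbabilityMeasure P]

instance (D : Innovations P) (U : Matrix (Fin nx) (Fin nx) ℝ) (a : Fin nx → ℝ) :
    IsProbabilityMeasure (D.gaussianLaw U a) :=
  Measure.isProbabilityMeasure_map (by fun_prop)

lemma Innovations.condIndepFun_gaussianLaw (D : Innovations P) (U : Matrix (Fin nx) (Fin nx) ℝ)
    (a : Fin nx → ℝ) : CondIndepFun
      (MeasurableSpace.comap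
        (fun q : Triple nx ny nz × EuclideanSpace ℝ (Fin nx) => q.1.2.1) inferInstance)
      (Measurable.comap_le (by fun_prop))
      (fun q : Triple nx ny nz × EuclideanSpace ℝ (Fin nx) => q.2)
      (fun q : Triple nx ny nz × EuclideanSpace ℝ (Fin nx) => (q.1.1, q.1.2.2))
      (D.gaussianLaw U a) := by
  have hf : Measurable fun t : Triple nx ny nz => (t.2.1, t.1, t.2.2) := by fun_prop
  refine condIndepFun_of_noise (ν := piGaussian 0 1)
    (k := fun q : Triple nx ny nz × EuclideanSpace ℝ (Fin nx) => q.1.2.1)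
    (by fun_prop) (by fun_prop) (by fun_prop) (ψ := D.channel U a) (by fun_prop) ?_
  have h1 := Measure.map_prod_map P (piGaussian (0 : Fin nx → ℝ) 1) hf measurable_id
  rw [Measure.map_id] at h1
  rw [D.map_gaussianLaw U a (by fun_prop), D.map_fst_gaussianLaw U a hf, h1,
    Measure.map_map (by fun_prop) (by fun_prop)]
  rfl

/-- The output of the channel with standard Gaussian noise, as an auxiliary vector. -/
noncomputable def Innovations.gaussianAux (D : Innovations P) (U : Matrix (Fin nx) (Fin nx) ℝ)
    (a : Fin nx → ℝ) : Auxiliary P nx where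
  law := D.gaussianLaw U a
  isProb := inferInstance
  marginal := (D.map_fst_gaussianLaw U a measurable_id).trans Measure.map_id
  markov := D.condIndepFun_gaussianLaw U a

lemma Innovations.map_gaussianAux (D : Innovations P) (U : Matrix (Fin nx) (Fin nx) ℝ)
    (a : Fin nx → ℝ) : (D.gaussianAux U a).law.map (fun q => (q.1, D.noise U a q)) =
      P.prod (piGaussian 0 1) := by
  refine (D.map_gaussianLaw U a (by fun_prop)).trans ?_
  convert Measure.map_id using 2
  ext1 p
  refine Prod.ext rfl ?_
  ext i
  simp [Innovations.noise, Innovations.channel]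

lemma Innovations.map_noise (D : Innovations P) (U : Matrix (Fin nx) (Fin nx) ℝ)
    (a : Fin nx → ℝ) : (D.gaussianAux U a).law.map (D.noise U a) = piGaussian 0 1 := by
  have h := Measure.map_map (μ := (D.gaussianAux U a).law) (g := Prod.snd) measurable_snd
    (f := fun q => (q.1, D.noise U a q)) (by fun_prop)
  rw [D.map_gaussianAux, Measure.map_snd_prod, measure_univ, one_smul] at h
  exact h.symm

lemma Innovations.indepFun_noise (D : Innovations P) (U : Matrix (Fin nx) (Fin nx) ℝ)
    (a : Fin nx → ℝ) : IndepFun Prod.fst (D.noise U a) (D.gaussianAux U a).law := by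
  rw [indepFun_iff_map_prod_eq_prod_map_map (by fun_prop) (by fun_prop), D.map_gaussianAux,
    D.map_noise, (D.gaussianAux U a).marginal]

end Achievability

section GaussianAux

variable {nx ny nz : ℕ} {P : Measure (Triple nx ny nz)} [IsGaussian P]
  {U : Matrix (Fin nx) (Fin nx) ℝ} {l m a : Fin nx → ℝ}

/-- The test channel of the innovation in the coordinates given by the rows of `U`. The last
statement is what makes `z` useless for the estimate of the innovation once `v = a w + n` is
known. -/
lemma Innovations.gaussianAux_testChannel (hmean : ∫ t, t ∂P = 0) (D : Innovations P)
    (hU : IsEigenDecomp (covXGivenZ P - covXGivenYZ P) U l) (hl : ∀ i, 0 < l i)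
    (hm : ∀ i, 0 < m i) (ha : ∀ i, a i ^ 2 = 1 / m i - 1 / l i) :
    (D.gaussianAux U a).law.map (fun q i => a i * D.rotInnov U q.1.2 i + D.noise U a q i) =
      piGaussian 0 (fun i => l i / m i) ∧
    (∀ i, ∫ q, (D.rotInnov U q.1.2 i - a i * m i * (a i * D.rotInnov U q.1.2 i +
      D.noise U a q i)) ∂(D.gaussianAux U a).law = 0) ∧
    (∀ i j, ∫ q, (D.rotInnov U q.1.2 i - a i * m i * (a i * D.rotInnov U q.1.2 i +
        D.noise U a q i)) *
      (D.rotInnov U q.1.2 j - a j * m j * (a j * D.rotInnov U q.1.2 j +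
        D.noise U a q j)) ∂(D.gaussianAux U a).law = Matrix.diagonal m i j) ∧
    IndepFun (fun q => q.1.2.2)
      (fun q i => a i * D.rotInnov U q.1.2 i + D.noise U a q i) (D.gaussianAux U a).law ∧
    IndepFun (fun q i => D.rotInnov U q.1.2 i - a i * m i * (a i * D.rotInnov U q.1.2 i +
        D.noise U a q i))
      (fun q => ((fun i => a i * D.rotInnov U q.1.2 i + D.noise U a q i), q.1.2.2))
      (D.gaussianAux U a).law := by
  set A := D.gaussianAux U a with hA
  have hmW : Measurable fun t : Triple nx ny nz => D.rotInnov U t.2 := by fun_prop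
  have hWG : HasGaussianLaw (fun q => D.rotInnov U q.1.2) A.law := by
    have h1 := Measure.map_map (μ := A.law) hmW measurable_fst
    rw [A.marginal, map_rotInnov D hmean hU] at h1
    exact ⟨by rw [show (fun q : Triple nx ny nz × EuclideanSpace ℝ (Fin nx) =>
      D.rotInnov U q.1.2) = (fun t => D.rotInnov U t.2) ∘ Prod.fst from rfl, ← h1]
              infer_instance⟩
  have hind := D.indepFun_noise U a
  obtain ⟨h1, h2, h3, h4⟩ := gaussian_testChannel (μ := A.law) hl hm ha hWG
    (fun i => (A.integral_comp_fst (f := fun t => D.rotInnov U t.2 i) (by fun_prop)).trans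
      (integral_rotInnov D hmean U i))
    (fun i j => (A.integral_comp_fst (f := fun t => D.rotInnov U t.2 i * D.rotInnov U t.2 j)
      (by fun_prop)).trans (integral_rotInnov_mul D hmean hU i j))
    (D.measurable_noise U a) (D.map_noise U a) (hind.comp hmW measurable_id)
  have hz : IndepFun (fun q : Triple nx ny nz × EuclideanSpace ℝ (Fin nx) => q.1.2.2)
      (fun q => (D.rotInnov U q.1.2, D.noise U a q)) A.law := by
    refine indepFun_prodMk_right (by fun_prop) (by fun_prop) (by fun_prop)
      (A.indepFun_comp_fst (f := fun t => t.2.2) (g := fun t => D.rotInnov U t.2)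
        (by fun_prop) (by fun_prop) ?_) ?_
    · exact (D.indep_innov.comp (φ := fun v : EuclideanSpace ℝ (Fin nx) => U *ᵥ v.ofLp) (ψ := id)
        (Continuous.matrix_mulVec continuous_const (by fun_prop)).measurable measurable_id).symm
    · exact hind.comp (φ := fun t : Triple nx ny nz => (t.2.2, D.rotInnov U t.2)) (ψ := id)
        (by fun_prop) measurable_id
  refine ⟨h1, h3, h4, ?_, ?_⟩
  · exact hz.comp (φ := id) (ψ := fun s : (Fin nx → ℝ) × (Fin nx → ℝ) =>
      fun i => a i * s.1 i + s.2 i) measurable_id (by fun_prop)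
  · refine indepFun_prodMk_right (by fun_prop) (by fun_prop) (by fun_prop) h2 ?_
    exact (hz.comp (φ := id) (ψ := fun s : (Fin nx → ℝ) × (Fin nx → ℝ) =>
      ((fun i => s.1 i - a i * m i * (a i * s.1 i + s.2 i)), fun i => a i * s.1 i + s.2 i))
      measurable_id (by fun_prop)).symm

lemma Innovations.errCov_gaussianAux (hmean : ∫ t, t ∂P = 0) (D : Innovations P)
    (hU : IsEigenDecomp (covXGivenZ P - covXGivenYZ P) U l) (hl : ∀ i, 0 < l i)
    (hm : ∀ i, 0 < m i) (ha : ∀ i, a i ^ 2 = 1 / m i - 1 / l i) :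
    (D.gaussianAux U a).errCov = covXGivenYZ P + Uᵀ * Matrix.diagonal m * U := by
  obtain ⟨hv, hr0, hrr, -, hr⟩ := D.gaussianAux_testChannel hmean hU hl hm ha
  set A := D.gaussianAux U a with hA
  have hUU : Uᵀ * U = 1 := by
    have := (Matrix.mem_orthogonalGroup_iff' (Fin nx) ℝ).1 hU.1
    simpa [Matrix.star_eq_conjTranspose] using this
  let v : Triple nx ny nz × EuclideanSpace ℝ (Fin nx) → Fin nx → ℝ := fun q i =>
    a i * D.rotInnov U q.1.2 i + D.noise U a q i
  let r : Triple nx ny nz × EuclideanSpace ℝ (Fin nx) → Fin nx → ℝ := fun q i =>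
    D.rotInnov U q.1.2 i - a i * m i * v q i
  have hrm : Measurable r := by fun_prop
  have hv2 : ∀ i, MemLp (fun q => v q i) 2 A.law := memLp_of_map_eq_piGaussian hv
  have hr2 : ∀ i, MemLp (fun q => r q i) 2 A.law := fun i =>
    ((memLp_rotInnov D U i).comp_measurePreserving A.measurePreserving_fst).sub
      ((hv2 i).const_mul (a i * m i))
  have hUr2 := memLp_mulVec hr2 Uᵀ
  have he2 : ∀ i, MemLp (fun q : Triple nx ny nz × EuclideanSpace ℝ (Fin nx) => D.err q.1 i) 2
      A.law := fun i => (memLp_apply (P := P) D.err i).comp_measurePreserving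
        A.measurePreserving_fst
  -- the estimate of `x` from `(u, z)`
  let g : EuclideanSpace ℝ (Fin nx) × EuclideanSpace ℝ (Fin nz) → EuclideanSpace ℝ (Fin nx) :=
    fun s => WithLp.toLp 2 (Uᵀ *ᵥ fun i => a i * m i * (s.1 i + a i * D.rotInnov U (0, s.2) i)) +
      D.pred s.2
  have hmulVec : Continuous fun b : Fin nx → ℝ => Uᵀ *ᵥ b :=
    Continuous.matrix_mulVec continuous_const continuous_id
  have hg : Measurable g := by
    have h1 : Continuous fun s : EuclideanSpace ℝ (Fin nx) × EuclideanSpace ℝ (Fin nz) =>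
        fun i => a i * m i * (s.1 i + a i * D.rotInnov U (0, s.2) i) := by fun_prop
    have h2 := (hmulVec.comp h1).measurable
    have h3 : Measurable fun b : Fin nx → ℝ => WithLp.toLp 2 b := by fun_prop
    exact (h3.comp h2).add (by fun_prop)
  have hgv : ∀ q, g (q.2, q.1.2.2) =
      WithLp.toLp 2 (Uᵀ *ᵥ fun i => a i * m i * v q i) + D.pred q.1.2.2 := fun q => by
    simp only [g, v, D.add_noise]
  let R : Triple nx ny nz × EuclideanSpace ℝ (Fin nx) → EuclideanSpace ℝ (Fin nx) := fun q =>
    D.err q.1 + WithLp.toLp 2 (Uᵀ *ᵥ r q)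
  have hxR : ∀ q, q.1.1 = R q + g (q.2, q.1.2.2) := fun q => by
    have h1 : D.innovT q.1 = WithLp.toLp 2 (Uᵀ *ᵥ r q) +
        WithLp.toLp 2 (Uᵀ *ᵥ fun i => a i * m i * v q i) := by
      rw [← WithLp.toLp_add, ← Matrix.mulVec_add]
      have h2 : r q + (fun i => a i * m i * v q i) = U *ᵥ (D.innovT q.1).ofLp := by
        ext i
        simp only [r, Pi.add_apply, sub_add_cancel]
        rfl
      rw [h2, Matrix.mulVec_mulVec, hUU, Matrix.one_mulVec]
    rw [hgv, D.eq_err_add q.1, h1]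
    simp only [R]
    abel
  have hR2 : ∀ i, MemLp (fun q => R q i) 2 A.law := fun i => (he2 i).add (hUr2 i)
  have hgw : ∀ i, Integrable (fun q : Triple nx ny nz × EuclideanSpace ℝ (Fin nx) =>
      g (q.2, q.1.2.2) i) A.law := fun i => by
    have h1 : MemLp (fun q : Triple nx ny nz × EuclideanSpace ℝ (Fin nx) => q.1.1 i - R q i) 2
      A.law := ((memLp_apply (P := P) (ContinuousLinearMap.fst ℝ _ _) i).comp_measurePreserving
        A.measurePreserving_fst).sub (hR2 i)
    refine (h1.integrable one_le_two).congr (Filter.Eventually.of_forall fun q => ?_)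
    show q.1.1 i - R q i = _
    rw [hxR q, PiLp.add_apply]
    ring
  -- `z` and `u` are functions of `z` and `v`
  have hrw : IndepFun r (fun q => (q.2, q.1.2.2)) A.law := by
    have h1 : Measurable fun s : (Fin nx → ℝ) × EuclideanSpace ℝ (Fin nz) =>
        ((WithLp.toLp 2 fun i => s.1 i - a i * D.rotInnov U (0, s.2) i :
          EuclideanSpace ℝ (Fin nx)), s.2) := by fun_prop
    have h2 : IndepFun r _ A.law := hr.comp measurable_id h1
    convert h2 using 1
    ext1 q
    refine Prod.ext ?_ rfl
    ext i
    simp [D.add_noise]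
  have hRz : ∀ i, A.law[fun q => R q i | MeasurableSpace.comap
      (fun q : Triple nx ny nz × EuclideanSpace ℝ (Fin nx) => (q.2, q.1.2.2)) inferInstance]
      =ᵐ[A.law] 0 := fun i => by
    have h1 := condExp_eq_zero_of_indepFun (μ := A.law)
      (f := fun q : Triple nx ny nz × EuclideanSpace ℝ (Fin nx) => D.err q.1 i)
      (w := fun q => (q.2, q.1.2.2)) (by fun_prop) (by fun_prop)
      ((A.indepFun_err D).comp (φ := fun b : EuclideanSpace ℝ (Fin nx) => b i)
        (ψ := fun s : (EuclideanSpace ℝ (Fin ny) × EuclideanSpace ℝ (Fin nz)) ×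
          EuclideanSpace ℝ (Fin nx) => (s.2, s.1.2)) (by fun_prop) (by fun_prop))
      ((A.integral_comp_fst (f := fun t => D.err t i) (by fun_prop)).trans
        (integral_apply_eq_zero hmean _ _))
    have hUr0 : ∫ q, (Uᵀ *ᵥ r q) i ∂A.law = 0 := by
      simp only [Matrix.mulVec, dotProduct]
      rw [integral_finsetSum _ fun k _ => ((hr2 k).integrable one_le_two).const_mul _]
      refine Finset.sum_eq_zero fun k _ => ?_
      rw [integral_const_mul, hr0 k, mul_zero]
    have h2 := condExp_eq_zero_of_indepFun (μ := A.law) (f := fun q => (Uᵀ *ᵥ r q) i)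
      (w := fun q => (q.2, q.1.2.2))
      ((measurable_pi_apply i).comp (hmulVec.measurable.comp hrm)) (by fun_prop)
      (hrw.comp ((measurable_pi_apply i).comp hmulVec.measurable) measurable_id) hUr0
    have h3 := condExp_add ((he2 i).integrable one_le_two) ((hUr2 i).integrable one_le_two)
      (MeasurableSpace.comap (fun q : Triple nx ny nz × EuclideanSpace ℝ (Fin nx) =>
        (q.2, q.1.2.2)) inferInstance)
    refine Filter.EventuallyEq.trans h3 ?_
    filter_upwards [h1, h2] with q h4 h5
    rw [Pi.add_apply, h4, h5, Pi.zero_apply, add_zero]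
  have heUr : ∀ i j, ∫ q, D.err q.1 i * (Uᵀ *ᵥ r q) j ∂A.law = 0 := fun i j => by
    let ψ : (EuclideanSpace ℝ (Fin ny) × EuclideanSpace ℝ (Fin nz)) × EuclideanSpace ℝ (Fin nx) →
        ℝ := fun s => (Uᵀ *ᵥ fun k => D.rotInnov U s.1 k - a k * m k *
          (s.2 k + a k * D.rotInnov U (0, s.1.2) k)) j
    have hψ : Measurable ψ := (measurable_pi_apply j).comp (hmulVec.measurable.comp
      (measurable_pi_lambda _ fun k => by fun_prop))
    have h1 := A.integral_err_mul hmean D hψ i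
    simpa only [ψ, r, v, D.add_noise] using h1
  ext i j
  have h1 := errCov_eq_of_condExp_eq_zero (μ := A.law)
    (x := fun q : Triple nx ny nz × EuclideanSpace ℝ (Fin nx) => q.1.1)
    (w := fun q => (q.2, q.1.2.2)) (r := R) (by fun_prop) hg hxR
    (fun i => (hR2 i).integrable one_le_two) hgw hRz i j
  have h2 := integral_lin_mul_lin (μ := A.law) (he2 i) (hUr2 i) (he2 j) (hUr2 j) 1 1 1 1
  have h3 : ∫ q, (Uᵀ *ᵥ r q) i * D.err q.1 j ∂A.law = 0 := by
    simp_rw [mul_comm ((Uᵀ *ᵥ r _) i)]; exact heUr j i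
  have h4 := integral_mulVec_mul_mulVec hr2 hr2 Uᵀ Uᵀ i j
  have h5 : (Matrix.of fun k l => ∫ q, r q k * r q l ∂A.law) = Matrix.diagonal m := by
    ext k l
    exact hrr k l
  rw [h5, Matrix.transpose_transpose] at h4
  rw [heUr, h3, h4, A.integral_comp_fst (f := fun t => D.err t i * D.err t j) (by fun_prop),
    ← covXGivenYZ_eq D hmean] at h2
  simp only [one_mul, mul_zero, add_zero, zero_add] at h2
  exact h1.trans h2

lemma Innovations.rate_gaussianAux_le (hmean : ∫ t, t ∂P = 0) (D : Innovations P)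
    (hU : IsEigenDecomp (covXGivenZ P - covXGivenYZ P) U l) (hl : ∀ i, 0 < l i)
    (hm : ∀ i, 0 < m i) (ha : ∀ i, a i ^ 2 = 1 / m i - 1 / l i) :
    (D.gaussianAux U a).rate ≤ ENNReal.ofReal (1 / 2 * ∑ i, Real.log (l i / m i)) := by
  obtain ⟨hv, -, -, hzv, -⟩ := D.gaussianAux_testChannel hmean hU hl hm ha
  have hnoise := D.map_noise U a
  set A := D.gaussianAux U a with hA
  have hlm : ∀ i, 0 < l i / m i := fun i => div_pos (hl i) (hm i)
  let φ : EuclideanSpace ℝ (Fin nz) × EuclideanSpace ℝ (Fin nx) → Fin nx → ℝ :=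
    fun s i => s.2 i + a i * D.rotInnov U (0, s.1) i
  let θ : EuclideanSpace ℝ (Fin nz) × (Fin nx → ℝ) → EuclideanSpace ℝ (Fin nx) :=
    fun s => WithLp.toLp 2 fun i => s.2 i - a i * D.rotInnov U (0, s.1) i
  have hφv : ∀ q : Triple nx ny nz × EuclideanSpace ℝ (Fin nx), φ (q.1.2.2, q.2) =
      fun i => a i * D.rotInnov U q.1.2 i + D.noise U a q i := fun q => by
    ext i; rw [D.add_noise]
  have h1 := condMutualInfo_le_klDiv (μ := A.law)
    (y := fun q : Triple nx ny nz × EuclideanSpace ℝ (Fin nx) => q.1.2.1) (u := fun q => q.2)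
    (z := fun q => q.1.2.2) (φ := φ) (by fun_prop) (by fun_prop) (by fun_prop) (by fun_prop)
    (by simp_rw [hφv]; exact hzv) (θ := θ) (by fun_prop)
    (fun s b => by ext i; simp [θ, φ])
  simp_rw [hφv] at h1
  rw [hv] at h1
  refine h1.trans (le_of_eq ?_)
  -- the joint law of `(z, y)` and `v` is that of a channel with additive noise
  set S := A.law.map fun q : Triple nx ny nz × EuclideanSpace ℝ (Fin nx) =>
    (q.1.2.2, q.1.2.1) with hS
  have hSm : Measurable fun q : Triple nx ny nz × EuclideanSpace ℝ (Fin nx) =>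
    (q.1.2.2, q.1.2.1) := by fun_prop
  have : IsProbabilityMeasure S := Measure.isProbabilityMeasure_map hSm.aemeasurable
  let h : EuclideanSpace ℝ (Fin nz) × EuclideanSpace ℝ (Fin ny) → Fin nx → ℝ :=
    fun s i => a i * D.rotInnov U (s.2, s.1) i
  have hh : Measurable h := by fun_prop
  have hκ : Measurable fun q : Triple nx ny nz × EuclideanSpace ℝ (Fin nx) =>
    ((q.1.2.2, q.1.2.1), D.noise U a q) := by fun_prop
  have hSN : A.law.map (fun q => ((q.1.2.2, q.1.2.1), D.noise U a q)) =
      S.prod (piGaussian 0 1) := by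
    have h2 := (indepFun_iff_map_prod_eq_prod_map_map hSm.aemeasurable (by fun_prop)).1
      ((D.indepFun_noise U a).comp (φ := fun t : Triple nx ny nz => (t.2.2, t.2.1)) (ψ := id)
        (by fun_prop) measurable_id)
    rw [← hnoise]
    exact h2
  have hjoint : A.law.map (fun q => ((q.1.2.2, q.1.2.1),
      fun i => a i * D.rotInnov U q.1.2 i + D.noise U a q i)) =
      (S.prod (piGaussian 0 1)).map fun p => (p.1, h p.1 + p.2) := by
    rw [← hSN, Measure.map_map (by fun_prop) hκ]
    rfl
  have hLm : Measurable fun p : (EuclideanSpace ℝ (Fin nz) × EuclideanSpace ℝ (Fin ny)) ×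
      (Fin nx → ℝ) => gaussianLLR 1 (fun i => l i / m i) (h p.1) (h p.1 + p.2) :=
    measurable_gaussianLLR _ _ (by fun_prop) (by fun_prop)
  have hsub : ∀ (q : Triple nx ny nz × EuclideanSpace ℝ (Fin nx)) (i : Fin nx),
      a i * D.rotInnov U q.1.2 i + D.noise U a q i - h (q.1.2.2, q.1.2.1) i = D.noise U a q i :=
    fun q i => add_sub_cancel_left _ _
  obtain ⟨hint, hval⟩ := integral_gaussianLLR (μ := A.law) 1 (fun i => l i / m i)
    (c := fun q => h (q.1.2.2, q.1.2.1))
    (x := fun q i => a i * D.rotInnov U q.1.2 i + D.noise U a q i)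
    (fun i => by simp_rw [hsub]; exact memLp_of_map_eq_piGaussian hnoise i)
    (memLp_of_map_eq_piGaussian hv)
  rw [hjoint, klDiv_map_add_noise S (v := 1) (fun _ => one_pos) hlm hh
    (by rw [← hSN]
        exact (integrable_map_measure hLm.aestronglyMeasurable hκ.aemeasurable).2 hint),
    ← hSN, integral_map hκ.aemeasurable hLm.aestronglyMeasurable]
  congr 1
  refine hval.trans ?_
  simp_rw [hsub]
  rw [Finset.mul_sum]
  refine Finset.sum_congr rfl fun i _ => ?_
  rw [integral_sq_of_map_eq_piGaussian (by fun_prop) (fun _ => zero_le_one) hnoise,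
    integral_sq_of_map_eq_piGaussian (by fun_prop) (fun i => (hlm i).le) hv]
  have h2 := (hlm i).ne'
  have h3 : l i / m i / (2 * (l i / m i)) = 1 / 2 := by
    rw [mul_comm 2, div_mul_eq_div_div, div_self h2]
  rw [h3, Pi.one_apply, div_one]
  ring

end GaussianAux


/-! ### Eigenvalue decompositions and the matrix minimum -/

section MatrixMin

variable {n : ℕ} {A B M U : Matrix (Fin n) (Fin n) ℝ} {l m : Fin n → ℝ}

lemma IsEigenDecomp.transpose_mul (h : IsEigenDecomp A U l) : Uᵀ * U = 1 := by
  have := (Matrix.mem_orthogonalGroup_iff' (Fin n) ℝ).1 h.1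
  simpa [Matrix.star_eq_conjTranspose] using this

lemma IsEigenDecomp.mul_transpose (h : IsEigenDecomp A U l) : U * Uᵀ = 1 :=
  mul_eq_one_comm.1 h.transpose_mul

lemma IsEigenDecomp.trace_eq (h : IsEigenDecomp A U l) : A.trace = ∑ i, l i := by
  rw [h.2, Matrix.trace_mul_comm, ← Matrix.mul_assoc, h.mul_transpose, one_mul,
    Matrix.trace_diagonal]

lemma IsEigenDecomp.det_eq (h : IsEigenDecomp A U l) : A.det = ∏ i, l i := by
  have h1 := congrArg Matrix.det h.transpose_mul
  rw [Matrix.det_mul, Matrix.det_one] at h1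
  rw [h.2, Matrix.det_mul, Matrix.det_mul, Matrix.det_diagonal, mul_right_comm, h1, one_mul]

lemma IsEigenDecomp.diagonal_eq (h : IsEigenDecomp A U l) : Matrix.diagonal l = U * A * Uᵀ := by
  rw [h.2]
  calc Matrix.diagonal l = (U * Uᵀ) * Matrix.diagonal l * (U * Uᵀ) := by
        rw [h.mul_transpose, one_mul, mul_one]
    _ = _ := by simp only [Matrix.mul_assoc]

lemma IsEigenDecomp.nonneg (h : IsEigenDecomp A U l) (hA : A.PosSemidef) (i : Fin n) : 0 ≤ l i := by
  have h1 := hA.mul_mul_conjTranspose_same U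
  rw [Matrix.conjTranspose_eq_transpose_of_trivial, ← h.diagonal_eq] at h1
  exact Matrix.posSemidef_diagonal_iff.1 h1 i

lemma IsEigenDecomp.pos (h : IsEigenDecomp A U l) (hA : A.PosDef) (i : Fin n) : 0 < l i := by
  refine lt_of_le_of_ne (h.nonneg hA.posSemidef i) fun h0 => ?_
  have h1 := hA.det_pos
  rw [h.det_eq, Finset.prod_eq_zero (Finset.mem_univ i) h0.symm] at h1
  exact lt_irrefl _ h1

lemma IsEigenDecomp.posSemidef (h : IsEigenDecomp A U l) (hl : ∀ i, 0 ≤ l i) : A.PosSemidef := by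
  have h1 := (Matrix.posSemidef_diagonal_iff.2 hl).conjTranspose_mul_mul_same U
  rwa [Matrix.conjTranspose_eq_transpose_of_trivial, ← h.2] at h1

lemma IsEigenDecomp.posDef (h : IsEigenDecomp A U l) (hl : ∀ i, 0 < l i) : A.PosDef := by
  have h1 := (h.posSemidef fun i => (hl i).le).posDef_iff_isUnit
  rw [h1, Matrix.isUnit_iff_isUnit_det, h.det_eq, isUnit_iff_ne_zero]
  exact (Finset.prod_pos fun i _ => hl i).ne'

/-- For `A ⪯ B` all the eigenvalues of `A^{-1/2} B A^{-1/2}` are at least `1`, so that the minimum of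
the two matrices is `A`. -/
lemma IsMatrixMin.eq_left (h : IsMatrixMin A B M) (hA : A.PosDef) (hAB : (B - A).PosSemidef) :
    M = A := by
  obtain ⟨U, W, S, V, l, g, -, hU, hS, -, hW, hV, hM⟩ := h
  have hl := hU.pos hA
  set R := Matrix.diagonal fun i => Real.sqrt (l i) with hR
  have hRR : R * R = Matrix.diagonal l := by
    rw [hR, Matrix.diagonal_mul_diagonal]
    congr 1
    ext i
    exact Real.mul_self_sqrt (hl i).le
  have hRdet : R.det ≠ 0 := by
    rw [hR, Matrix.det_diagonal]
    exact (Finset.prod_pos fun i _ => Real.sqrt_pos.2 (hl i)).ne'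
  have hSS : S * S = A := by
    rw [hU.2, ← hRR, hS]
    calc Uᵀ * R * U * (Uᵀ * R * U) = Uᵀ * R * (U * Uᵀ) * R * U := by simp only [Matrix.mul_assoc]
      _ = Uᵀ * (R * R) * U := by rw [hU.mul_transpose, mul_one]; simp only [Matrix.mul_assoc]
  have hSt : Sᵀ = S := by
    rw [hS, hR]
    simp [Matrix.transpose_mul, Matrix.mul_assoc]
  have hSdet : IsUnit S.det := by
    have h1 := hA.det_pos.ne'
    rw [← hSS, Matrix.det_mul] at h1
    exact isUnit_iff_ne_zero.2 (left_ne_zero_of_mul h1)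
  have hSA : S⁻¹ * A * S⁻¹ = 1 := by
    rw [← hSS, ← Matrix.mul_assoc, Matrix.nonsing_inv_mul _ hSdet, one_mul,
      Matrix.mul_nonsing_inv _ hSdet]
  have hSit : (S⁻¹)ᵀ = S⁻¹ := by rw [Matrix.transpose_nonsing_inv, hSt]
  have hg : ∀ i, 1 ≤ g i := fun i => by
    have h1 : IsEigenDecomp (S⁻¹ * (B - A) * S⁻¹) W (fun i => g i - 1) := by
      refine ⟨hW.1, ?_⟩
      have h2 : Matrix.diagonal (fun i => g i - 1) = Matrix.diagonal g - 1 := by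
        rw [← Matrix.diagonal_one, Matrix.diagonal_sub]
      rw [Matrix.mul_sub, Matrix.sub_mul, hSA, hW.2, h2, Matrix.mul_sub, Matrix.sub_mul, mul_one,
        hW.transpose_mul]
    have h3 := hAB.mul_mul_conjTranspose_same S⁻¹
    rw [Matrix.conjTranspose_eq_transpose_of_trivial, hSit] at h3
    linarith [h1.nonneg h3 i]
  have hmin : (fun i => min (l i) (l i * g i)) = l := by
    ext i
    exact min_eq_left (le_mul_of_one_le_right (hl i).le (hg i))
  have hVA : V * A * Vᵀ = Matrix.diagonal l := by
    have hRt : Rᵀ = R := by rw [hR, Matrix.diagonal_transpose]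
    rw [hV, Matrix.transpose_mul, Matrix.transpose_mul, hSit, hRt, ← hRR]
    calc R * W * S⁻¹ * A * (S⁻¹ * (Wᵀ * R)) = R * (W * (S⁻¹ * A * S⁻¹) * Wᵀ) * R := by
          simp only [Matrix.mul_assoc]
      _ = R * R := by rw [hSA, mul_one, hW.mul_transpose, mul_one]
  have hVdet : IsUnit V.det := by
    have h1 : (V * A * Vᵀ).det ≠ 0 := by
      rw [hVA, Matrix.det_diagonal]
      exact (Finset.prod_pos fun i _ => hl i).ne'
    rw [Matrix.det_mul, Matrix.det_mul] at h1
    exact isUnit_iff_ne_zero.2 (left_ne_zero_of_mul (left_ne_zero_of_mul h1))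
  have hVt : Vᵀ * (V⁻¹)ᵀ = 1 := by
    rw [← Matrix.transpose_mul, Matrix.nonsing_inv_mul _ hVdet, Matrix.transpose_one]
  rw [hM, hmin, ← hVA]
  calc V⁻¹ * (V * A * Vᵀ) * (V⁻¹)ᵀ = (V⁻¹ * V) * A * (Vᵀ * (V⁻¹)ᵀ) := by
        simp only [Matrix.mul_assoc]
    _ = A := by rw [Matrix.nonsing_inv_mul _ hVdet, hVt, one_mul, mul_one]

lemma matrixMin_eq_left (hA : A.PosDef) (hAB : (B - A).PosSemidef) : matrixMin A B = A := by
  have hB : B.IsHermitian := by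
    have := hAB.isHermitian.add hA.isHermitian
    rwa [sub_add_cancel] at this
  exact (isMatrixMin_matrixMin hA.isHermitian hB).eq_left hA hAB

end MatrixMin

/-! ### Water levels -/

section WaterLevel

lemma exists_sum_min_eq {ι : Type*} [Fintype ι] {l : ι → ℝ} (hl : ∀ i, 0 ≤ l i) {c : ℝ}
    (hc : 0 ≤ c) (hc' : c ≤ ∑ i, l i) : ∃ lam, ∑ i, min lam (l i) = c := by
  have hcont : ContinuousOn (fun x => ∑ i, min x (l i)) (Set.Icc 0 (∑ i, l i)) :=
    Continuous.continuousOn (by fun_prop)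
  have h0 : ∑ i, min 0 (l i) = 0 := Finset.sum_eq_zero fun i _ => min_eq_left (hl i)
  have h1 : ∑ i, min (∑ j, l j) (l i) = ∑ i, l i := Finset.sum_congr rfl fun i _ =>
    min_eq_right (Finset.single_le_sum (fun j _ => hl j) (Finset.mem_univ i))
  obtain ⟨x, -, hx⟩ := intermediate_value_Icc (Finset.sum_nonneg fun i _ => hl i) hcont
    (show c ∈ Set.Icc (∑ i, min 0 (l i)) (∑ i, min (∑ j, l j) (l i)) by
      rw [h0, h1]; exact ⟨hc, hc'⟩)
  exact ⟨x, hx⟩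

variable {nx ny nz : ℕ} {P : Measure (Triple nx ny nz)} {U : Matrix (Fin nx) (Fin nx) ℝ}
  {l : Fin nx → ℝ} {lam : ℝ}

lemma IsWaterLevel.pos {D : ℝ} (h : IsWaterLevel P D l lam)
    (hD : (covXGivenYZ P).trace < nx * D) : 0 < lam := by
  by_contra hlam
  have h1 : ∑ i, min lam (l i) ≤ 0 := Finset.sum_nonpos fun i _ =>
    (min_le_left _ _).trans (not_lt.1 hlam)
  rw [h] at h1
  linarith

lemma isEigenDecomp_waterFillingMatrix (hU : IsEigenDecomp (covXGivenZ P - covXGivenYZ P) U l) :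
    IsEigenDecomp (waterFillingMatrix P U l lam - covXGivenYZ P) U (fun i => min lam (l i)) :=
  ⟨hU.1, add_sub_cancel_left _ _⟩

lemma IsWaterLevel.trace_waterFillingMatrix {D : ℝ} (h : IsWaterLevel P D l lam)
    (hU : IsEigenDecomp (covXGivenZ P - covXGivenYZ P) U l) :
    (waterFillingMatrix P U l lam).trace = nx * D := by
  have h1 := (isEigenDecomp_waterFillingMatrix (lam := lam) hU).trace_eq
  rw [Matrix.trace_sub, h] at h1
  linarith

lemma covRateFormula_waterFillingMatrix (hU : IsEigenDecomp (covXGivenZ P - covXGivenYZ P) U l)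
    (hl : ∀ i, 0 < l i) (hlam : 0 < lam) :
    covRateFormula P (waterFillingMatrix P U l lam) =
      1 / 2 * ∑ i, Real.log (l i / min lam (l i)) := by
  have hm : ∀ i, 0 < min lam (l i) := fun i => lt_min hlam (hl i)
  have hE := isEigenDecomp_waterFillingMatrix (lam := lam) hU
  have hdiff : IsEigenDecomp ((covXGivenZ P - covXGivenYZ P) -
      (waterFillingMatrix P U l lam - covXGivenYZ P)) U (fun i => l i - min lam (l i)) := by
    refine ⟨hU.1, ?_⟩
    rw [hE.2, hU.2, ← Matrix.diagonal_sub, Matrix.mul_sub, Matrix.sub_mul]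
  rw [covRateFormula, matrixMin_eq_left (hE.posDef hm)
    (hdiff.posSemidef fun i => sub_nonneg.2 (min_le_right _ _)), hE.det_eq, hU.det_eq,
    ← Finset.prod_div_distrib, Real.log_prod fun i _ => (div_pos (hl i) (hm i)).ne']

lemma div_min_eq_max {x y : ℝ} (hx : 0 < x) (hy : 0 < y) : x / min y x = max (x / y) 1 := by
  rcases le_total y x with h | h
  · rw [min_eq_left h, max_eq_left ((one_le_div hy).2 h)]
  · rw [min_eq_right h, max_eq_right ((div_le_one hy).2 h), div_self hx.ne']

end WaterLevel

end RemoteWynerZiv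

theorem mainTheorem3 {nx ny nz : ℕ} (P : Measure (RemoteWynerZiv.Triple nx ny nz)) [IsGaussian P]
    (hmean : ∫ t, t ∂P = 0)
    (hrank : (RemoteWynerZiv.covXGivenZ P - RemoteWynerZiv.covXGivenYZ P).PosDef)
    (U : Matrix (Fin nx) (Fin nx) ℝ) (l : Fin nx → ℝ)
    (hU : RemoteWynerZiv.IsEigenDecomp
      (RemoteWynerZiv.covXGivenZ P - RemoteWynerZiv.covXGivenYZ P) U l)
    (D : ℝ) (hD : (RemoteWynerZiv.covXGivenYZ P).trace < nx * D)
    (hD' : nx * D ≤ (RemoteWynerZiv.covXGivenZ P).trace) :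
    (∃ lam, RemoteWynerZiv.IsWaterLevel P D l lam) ∧
    ∀ lam, RemoteWynerZiv.IsWaterLevel P D l lam →
      -- the matrix `𝐃*` is a valid distortion matrix
      (RemoteWynerZiv.waterFillingMatrix P U l lam - RemoteWynerZiv.covXGivenYZ P).PosDef ∧
      -- both rate-distortion functions are minima
      IsLeast (RemoteWynerZiv.covRates P (RemoteWynerZiv.waterFillingMatrix P U l lam))
        (RemoteWynerZiv.rdfCov P (RemoteWynerZiv.waterFillingMatrix P U l lam)) ∧
      IsLeast (RemoteWynerZiv.mseRates P D) (RemoteWynerZiv.rdfMSE P D) ∧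
      -- `R(𝐃*)` is given by the closed form for covariance constraints
      RemoteWynerZiv.rdfCov P (RemoteWynerZiv.waterFillingMatrix P U l lam) =
        ENNReal.ofReal (RemoteWynerZiv.covRateFormula P
          (RemoteWynerZiv.waterFillingMatrix P U l lam)) ∧
      RemoteWynerZiv.covRateFormula P (RemoteWynerZiv.waterFillingMatrix P U l lam) =
        1 / 2 * ∑ i, Real.log (l i / min lam (l i)) ∧
      RemoteWynerZiv.covRateFormula P (RemoteWynerZiv.waterFillingMatrix P U l lam) =
        1 / 2 * ∑ i, Real.log (max (l i / lam) 1) ∧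
      -- the rate-distortion function under the mean-squared error constraint is its value at `𝐃*`
      RemoteWynerZiv.rdfMSE P D =
        ENNReal.ofReal (1 / 2 * ∑ i, Real.log (max (l i / lam) 1)) ∧
      RemoteWynerZiv.rdfCov P (RemoteWynerZiv.waterFillingMatrix P U l lam) =
        RemoteWynerZiv.rdfMSE P D := by
  have hl := hU.pos hrank
  have htr := hU.trace_eq
  rw [Matrix.trace_sub] at htr
  refine ⟨RemoteWynerZiv.exists_sum_min_eq (fun i => (hl i).le) (by linarith) (by linarith),
    fun lam hw => ?_⟩
  have hlam := hw.pos hD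
  have hm : ∀ i, 0 < min lam (l i) := fun i => lt_min hlam (hl i)
  obtain ⟨I⟩ := RemoteWynerZiv.nonempty_innovations hmean
  set DD := RemoteWynerZiv.waterFillingMatrix P U l lam with hDD
  have hformula := RemoteWynerZiv.covRateFormula_waterFillingMatrix hU hl hlam
  have hmax : ∑ i, Real.log (l i / min lam (l i)) = ∑ i, Real.log (max (l i / lam) 1) :=
    Finset.sum_congr rfl fun i _ => by rw [RemoteWynerZiv.div_min_eq_max (hl i) hlam]
  set r := ENNReal.ofReal (1 / 2 * ∑ i, Real.log (l i / min lam (l i))) with hr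
  -- the water-filling value bounds all the rates under the mean-squared error constraint
  have hlow : r ∈ lowerBounds (RemoteWynerZiv.mseRates P D) := by
    rintro - ⟨m, b, hb, rfl⟩
    exact b.le_rate hmean I hU hl hlam hw hb
  have hsub : RemoteWynerZiv.covRates P DD ⊆ RemoteWynerZiv.mseRates P D := by
    rintro - ⟨m, b, hb, rfl⟩
    refine ⟨m, b, ?_, rfl⟩
    have h1 := hb.trace_nonneg
    rw [Matrix.trace_sub, hw.trace_waterFillingMatrix hU] at h1
    linarith
  have hmem : r ∈ RemoteWynerZiv.covRates P DD := by
    have ha : ∀ i, Real.sqrt (1 / min lam (l i) - 1 / l i) ^ 2 = 1 / min lam (l i) - 1 / l i :=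
      fun i => Real.sq_sqrt (sub_nonneg.2 (one_div_le_one_div_of_le (hm i) (min_le_right _ _)))
    let b := I.gaussianAux U fun i => Real.sqrt (1 / min lam (l i) - 1 / l i)
    have hb : b.errCov = DD := I.errCov_gaussianAux hmean hU hl hm ha
    have hPSD : (DD - b.errCov).PosSemidef := by
      rw [hb, sub_self]
      exact Matrix.PosSemidef.zero
    exact ⟨nx, b, hPSD, le_antisymm (I.rate_gaussianAux_le hmean hU hl hm ha)
      (hlow (hsub ⟨nx, b, hPSD, rfl⟩))⟩
  have hcov : IsLeast (RemoteWynerZiv.covRates P DD) r := ⟨hmem, fun s hs => hlow (hsub hs)⟩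
  have hmse : IsLeast (RemoteWynerZiv.mseRates P D) r := ⟨hsub hmem, hlow⟩
  have hcov_eq : RemoteWynerZiv.rdfCov P DD = r := hcov.isGLB.sInf_eq
  have hmse_eq : RemoteWynerZiv.rdfMSE P D = r := hmse.isGLB.sInf_eq
  refine ⟨(RemoteWynerZiv.isEigenDecomp_waterFillingMatrix hU).posDef hm, ?_, ?_, ?_, hformula,
    ?_, ?_, ?_⟩
  · rw [hcov_eq]; exact hcov
  · rw [hmse_eq]; exact hmse
  · rw [hcov_eq, hformula]
  · rw [hformula, hmax]
  · rw [hmse_eq, hr, hmax]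
  · rw [hcov_eq, hmse_eq]
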